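/- **Setting.** Fix $d\ge 0$, a scaling $\mathfrak s\in\mathbb N_{\ge1}^{d+1}$ with $|k|_{\mathfrak s}=\sum_i\mathfrak s_ik_i$, a finite set $\mathfrak L_-$ of noise types and a set $\mathfrak L_+$ of kernel types, $\mathfrak L=\mathfrak L_-\sqcup\mathfrak L_+$, a homogeneity $|\cdot|_{\mathfrak s}:\mathfrak L\to\mathbb R$, extended additively to $\mathbb Z^{d+1}\oplus\mathbb Z(\mathfrak L)$, where $\mathbb Z(\mathfrak L)$ is the free abelian group on $\mathfrak L$, and for every $\mathfrak t\in\mathfrak L_+$ an integrable, compactly supported kernel $K_{\mathfrak t}:\mathbb R^{d+1}\to\mathbb R$. A *decorated tree* is a finite rooted (non-planar) tree $\tau$ with an edge type map $\mathfrak t:E\to\mathfrak L$, edge decorations $\mathfrak e:E\to\mathbb N^{d+1}$, vertex decorations $\mathfrak n\in\mathbb N^{d+1}$, and a set of coloured (contracted) vertices that carry extended decorations $\mathfrak o\in\mathbb Z^{d+1}\oplus\mathbb Z(\mathfrak L)$ (put $\mathfrak o=0$ on uncoloured vertices); edges of noise type end in uncoloured leaves with $\mathfrak n=0$. Let $|\tau|_-=\sum_{e}(|\mathfrak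 t(e)|_{\mathfrak s}-|\mathfrak e(e)|_{\mathfrak s})+\sum_x|\mathfrak n(x)|_{\mathfrak s}$ and $|\tau|_+=|\tau|_-+\sum_x|\mathfrak o(x)|_{\mathfrak s}$. A rule $R$ assigns to every $\mathfrak t\in\mathfrak L$ a non-empty set $R(\mathfrak t)$ of finite multisets in $\mathfrak L\times\mathbb N^{d+1}$, with $R(\Xi)=\{\emptyset\}$ for $\Xi\in\mathfrak L_-$. A tree conforms to $R$ if at the end of every edge of type $\mathfrak t$ the multiset of the pairs $(\mathfrak t(e),\mathfrak e(e))$ of the outgoing edges $e$ belongs to $R(\mathfrak t)$, and if the one at the root belongs to $R(\mathfrak t)$ for some $\mathfrak t\in\mathfrak L$. Let $\mathcal T^{ex}$ be the real vector space spanned by the conforming trees, let $\mathcal T_-^{ex}$ be the free commutative algebra generated by the conforming trees with $|\tau|_-<0$, and let $\mathcal G_-^{ex}$ be the set of its characters (unital algebra morphisms $g:\mathcal T_-^{ex}\to\mathbb R$). **Renormalisation.** For a tree $\tau$ put $$\Delta_-^{ex}\tau=\sum_{A}\sum_{\mathfrak n_A,\varepsilon}\frac1{\varepsilon!}\binom{\mathfrak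 n}{\mathfrak n_A}\,(A,\mathfrak n_A+\pi\varepsilon,\mathfrak o,\mathfrak e)\otimes\tau/A ,$$ where $A$ runs over the subforests of $\tau$ given by sets of edges, $\mathfrak n_A\le\mathfrak n$ is supported on the vertices of $A$, $\varepsilon$ is $\mathbb N^{d+1}$-valued and supported on the edges outside of $A$ that start at a vertex of $A$, and $\pi\varepsilon(x)$ is the sum of $\varepsilon(e)$ over the edges $e$ starting at $x$. The left factor is the product over the connected components of $A$, with their colours, and vanishes unless all of them are generators of $\mathcal T_-^{ex}$; $\tau/A$ is obtained by contracting each component $C$ of $A$ to a coloured vertex with polynomial decoration $\sum_{x\in C}(\mathfrak n-\mathfrak n_A)(x)$ and extended decoration $\sum_{x\in C}(\mathfrak o+\mathfrak n_A+\pi\varepsilon)(x)+\sum_{e\in C}(\mathfrak t(e)-\mathfrak e(e))$, and replacing $\mathfrak e$ by $\mathfrak e+\varepsilon$ and $\mathfrak n$ by $\mathfrak n-\mathfrak n_A$ elsewhere. (If $R$ is normal and complete, contractions of conforming trees along conforming components of negative degree conform again; for an arbitrary rule $\Delta_-^{ex}$ takes values in the tensor product of $\mathcal T_-^{ex}$ with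 the span of all decorated trees.) For $g\in\mathcal G_-^{ex}$ let $M^g=(g\otimes\mathrm{Id})\Delta_-^{ex}$. **Canonical lift.** For smooth $f=(f_\Xi)_{\Xi\in\mathfrak L_-}$, $f_\Xi\in C^\infty(\mathbb R^{d+1})$, and $z\in\mathbb R^{d+1}$, the linear map $\Pi^f_z$ from the span of the trees to functions on $\mathbb R^{d+1}$ is the one of the canonical lift $Z^f=(\Pi^f,\Gamma^f)$: if the root of $\tau$ has polynomial decoration $n$, outgoing noise edges $(\Xi_i,k_i)$, and outgoing kernel edges $(\mathfrak t_j,l_j)$ leading to trees $\sigma_j$, then $$\Pi^f_z\tau(x)=(x-z)^n\prod_iD^{k_i}f_{\Xi_i}(x)\prod_j\Big(D^{l_j}(K_{\mathfrak t_j}*\Pi^f_z\sigma_j)(x)-\sum_{|m|_{\mathfrak s}<|\mathfrak t_j|_{\mathfrak s}-|l_j|_{\mathfrak s}+|\sigma_j|_+}\frac{(x-z)^m}{m!}D^{l_j+m}(K_{\mathfrak t_j}*\Pi^f_z\sigma_j)(z)\Big).$$ **Onefold extension.** Let $\hat{\mathfrak L}_-=\{\hat\Xi:\Xi\in\mathfrak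 L_-\}$ be a disjoint copy of $\mathfrak L_-$ with $|\hat\Xi|_{\mathfrak s}=|\Xi|_{\mathfrak s}$, and let $\mathfrak q$ be the map on $\mathfrak L\sqcup\hat{\mathfrak L}_-$ that is the identity on $\mathfrak L$ and maps $\hat\Xi$ to $\Xi$. The extended rule is $\hat R(\mathfrak t)=\{N:\mathfrak qN\in R(\mathfrak t)\}$ for $\mathfrak t\in\mathfrak L_+$ and $\{\emptyset\}$ for noise types. It yields the extended spaces $\hat{\mathcal T}^{ex}\supset\mathcal T^{ex}$, $\hat{\mathcal T}^{ex}_-\supset\mathcal T^{ex}_-$ and extended operators. A character $g\in\mathcal G_-^{ex}$ is viewed as a character of $\hat{\mathcal T}_-^{ex}$ by letting it vanish on the generating trees outside of $\mathcal T_-^{ex}$. For $h,k\in C^\infty(\mathbb R^{d+1})^{\mathfrak L_-}$ let $\hat\Pi^{h,k}_z$ be the map $\Pi_z$ of the canonical lift for the noise types $\mathfrak L_-\sqcup\hat{\mathfrak L}_-$ of the tuple that assigns $h_\Xi$ to $\Xi$ and $k_\Xi$ to $\hat\Xi$. The shift operator $\mathcal S:\mathcal T^{ex}\to\hat{\mathcal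 T}^{ex}$ is the linear map $$\mathcal S(\tau,\mathfrak t)=\sum_{\tilde{\mathfrak t}}(\tau,\tilde{\mathfrak t}),$$ where the sum runs over all maps $\tilde{\mathfrak t}:E(\tau)\to\mathfrak L\sqcup\hat{\mathfrak L}_-$ with $\mathfrak q\circ\tilde{\mathfrak t}=\mathfrak t$, and all other decorations are kept. **Lemma.** For all rules $R$ (in particular for all complete and subcritical ones), all $h,k\in C^\infty(\mathbb R^{d+1})^{\mathfrak L_-}$, all $g\in\mathcal G_-^{ex}$ and all $z\in\mathbb R^{d+1}$, $$\Pi^{h+k}_z\,M^g=\hat\Pi^{h,k}_z\,M^g\,\mathcal S\qquad\text{on }\mathcal T^{ex}.$$ -/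

import Mathlib

open scoped ContDiff Convolution TensorProduct

namespace RegStruct

noncomputable section

/-! ### Rooted trees

`RTree N A B` is the type of finite, non-planar rooted trees (i.e. rooted trees up to isomorphism)
with vertices decorated by `N` and two sorts of edges: *leaf edges* decorated by `A`, which end
in an undecorated leaf, and *inner edges* decorated by `B`, which lead to another tree.
Thus a tree consists of the decoration of its root, the finite multiset of leaf edges at the root
and the finite multiset of inner edges at the root, each with the tree it leads to; `RTree N A B`
is the initial algebra of the corresponding functor. -/

/-- The data at the root: decoration, leaf edges, inner edges with what they lead to. -/
def TreeF (N A B X : Type) : Type := N × Multiset A × Multiset (B × X)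

instance TreeF.instFunctor (N A B : Type) : Functor (TreeF N A B) where
  map f x := (x.1, x.2.1, x.2.2.map (fun p => (p.1, f p.2)))

theorem map_univ_get {X Y : Type} (l : List X) (m : ℕ) (hm : m = l.length)
    (f : Fin m → Y) (g : X → Y) (h : ∀ i : Fin m, f i = g (l.get (Fin.cast hm i))) :
    (Finset.univ : Finset (Fin m)).val.map f = (l : Multiset X).map g := by
  subst hm
  have hf : f = fun i => g (l.get i) := funext h
  rw [hf, Fin.univ_val_map, Multiset.map_coe]
  congr 1
  rw [List.ofFn_eq_map, ← Function.comp_def g l.get, ← List.map_map, List.map_get_finRange]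

instance TreeF.instQPF (N A B : Type) : QPF (TreeF N A B) where
  P := ⟨N × Multiset A × List B, fun a => Fin a.2.2.length⟩
  abs := fun p => (p.1.1, p.1.2.1,
    (Finset.univ : Finset (Fin p.1.2.2.length)).val.map (fun i => (p.1.2.2.get i, p.2 i)))
  repr := fun x => ⟨(x.1, x.2.1, x.2.2.toList.map Prod.fst),
    fun i => (x.2.2.toList.get (Fin.cast (List.length_map _) i)).2⟩
  abs_repr := by
    rintro α ⟨n, a, c⟩
    refine Prod.ext rfl (Prod.ext rfl ?_)
    refine (map_univ_get c.toList _ (List.length_map _) _ id ?_).trans ?_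
    · intro i
      refine Prod.ext ?_ rfl
      simp
    · simp
  abs_map := by
    rintro α β f ⟨⟨n, a, l⟩, v⟩
    refine Prod.ext rfl (Prod.ext rfl ?_)
    exact (Multiset.map_map (fun p : B × α => (p.1, f p.2)) (fun i => (l.get i, v i))
      (Finset.univ : Finset (Fin l.length)).val).symm

/-- Finite non-planar rooted trees. -/
def RTree (N A B : Type) : Type := QPF.Fix (TreeF N A B)

namespace RTree

variable {N A B : Type}

/-- The tree with given root decoration, leaf edges and inner edges. -/
def node (n : N) (as : Multiset A) (bs : Multiset (B × RTree N A B)) : RTree N A B :=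
  QPF.Fix.mk (F := TreeF N A B) (n, as, bs)

/-- Definition by recursion on trees. -/
def fold {α : Type} (g : N → Multiset A → Multiset (B × α) → α) : RTree N A B → α :=
  QPF.Fix.rec (F := TreeF N A B) (fun x => g x.1 x.2.1 x.2.2)

theorem fold_node {α : Type} (g : N → Multiset A → Multiset (B × α) → α)
    (n : N) (as : Multiset A) (bs : Multiset (B × RTree N A B)) :
    fold g (node n as bs) = g n as (bs.map fun p => (p.1, fold g p.2)) :=
  QPF.Fix.rec_eq (F := TreeF N A B) _ _

theorem induction {p : RTree N A B → Prop}
    (h : ∀ n as bs, (∀ x ∈ bs, p x.2) → p (node n as bs)) (τ : RTree N A B) : p τ := by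
  refine QPF.Fix.ind (F := TreeF N A B) p ?_ τ
  rintro x ⟨u, rfl⟩
  refine h _ _ _ ?_
  intro x hx
  obtain ⟨y, -, rfl⟩ := Multiset.mem_map.1 hx
  exact y.2.2

/-- The multiset of all trees obtained by replacing every vertex decoration `n` by some element of
`fN n`, every leaf edge decoration `a` by some element of `fA a` and every inner edge decoration
`b` by some element of `fB b`. There is one entry for every such choice, so different choices that
give isomorphic trees are counted separately. -/
def choices {N' A' B' : Type} (fN : N → Multiset N') (fA : A → Multiset A')
    (fB : B → Multiset B') : RTree N A B → Multiset (RTree N' A' B') :=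
  fold fun n as bs =>
    (fN n ×ˢ ((as.map fA).Sections ×ˢ (bs.map fun p => fB p.1 ×ˢ p.2).Sections)).map
      fun c => node c.1 c.2.1 c.2.2

/-- Change of decorations. -/
def map {N' A' B' : Type} (fN : N → N') (fA : A → A') (fB : B → B') :
    RTree N A B → RTree N' A' B' :=
  fold fun n as bs => node (fN n) (as.map fA) (bs.map fun p => (fB p.1, p.2))

end RTree

/-! ### Types, scalings, kernels, decorated trees

`LM` is the (finite) set of noise types, `LP` the (finite) set of kernel types,
space-time is `Fin (d + 1) → ℝ`. -/

/-- Multi-indices. -/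
abbrev MI (d : ℕ) : Type := Fin (d + 1) → ℕ

/-- Space-time. -/
abbrev Pt (d : ℕ) : Type := Fin (d + 1) → ℝ

/-- A scaling, a homogeneity for every type, and an integrable kernel of compact support for
every kernel type. -/
structure Setting (LM LP : Type) (d : ℕ) where
  scaling : Fin (d + 1) → ℕ
  scaling_pos : ∀ i, 1 ≤ scaling i
  homNoise : LM → ℝ
  homKer : LP → ℝ
  kernel : LP → Pt d → ℝ
  kernel_integrable : ∀ t, MeasureTheory.Integrable (kernel t)
  kernel_compact : ∀ t, HasCompactSupport (kernel t)

/-- Values of the extended decoration: `ℤ^{d+1} ⊕ ℤ(𝔏)`, where `𝔏` is the set of all types. -/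
abbrev ODec (LM LP : Type) (d : ℕ) : Type := (Fin (d + 1) → ℤ) × ((LM ⊕ LP) →₀ ℤ)

/-- Vertex decorations: the polynomial decoration `𝔫`, and the colour together with the
extended decoration `𝔬`: `none` is an uncoloured vertex (for which `𝔬 = 0`), and `some o` is a
coloured vertex (a contracted subtree) with extended decoration `o`. -/
abbrev NodeDec (LM LP : Type) (d : ℕ) : Type := MI d × Option (ODec LM LP d)

/-- Typed decorated trees. Every edge carries a type and a derivative decoration `𝔢`. The edges of
noise type are the leaf edges. -/
abbrev DTree (LM LP : Type) (d : ℕ) : Type :=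
  RTree (NodeDec LM LP d) (LM × MI d) (LP × MI d)

variable {LM LP : Type} {d : ℕ}

/-- The scaled degree of a multi-index. -/
def Setting.mdeg (s : Setting LM LP d) (k : MI d) : ℝ := ∑ i, (s.scaling i : ℝ) * k i

/-- The homogeneity of a type. -/
def Setting.hom (s : Setting LM LP d) : LM ⊕ LP → ℝ := Sum.elim s.homNoise s.homKer

/-- The homogeneity of an extended decoration. -/
def Setting.odeg (s : Setting LM LP d) (o : ODec LM LP d) : ℝ :=
  (∑ i, (s.scaling i : ℝ) * o.1 i) + o.2.sum fun t c => (c : ℝ) * s.hom t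

/-- The degree `|τ|₋`, which disregards the extended decoration. -/
def Setting.degMinus (s : Setting LM LP d) : DTree LM LP d → ℝ :=
  RTree.fold fun n as bs => s.mdeg n.1 + (as.map fun a => s.homNoise a.1 - s.mdeg a.2).sum
    + (bs.map fun p => s.homKer p.1.1 - s.mdeg p.1.2 + p.2).sum

/-- The degree `|τ|₊`, which takes the extended decoration into account. -/
def Setting.degPlus (s : Setting LM LP d) : DTree LM LP d → ℝ :=
  RTree.fold fun n as bs => s.mdeg n.1 + n.2.elim 0 s.odeg
    + (as.map fun a => s.homNoise a.1 - s.mdeg a.2).sum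
    + (bs.map fun p => s.homKer p.1.1 - s.mdeg p.1.2 + p.2).sum

/-! ### Rules and the spaces they generate -/

/-- The type of a vertex: the multiset of the types and derivative decorations of its outgoing
edges. -/
def nodeType {X : Type} (as : Multiset (LM × MI d)) (bs : Multiset ((LP × MI d) × X)) :
    Multiset ((LM ⊕ LP) × MI d) :=
  as.map (fun a => (Sum.inl a.1, a.2)) + bs.map (fun p => (Sum.inr p.1.1, p.1.2))

/-- A rule prescribes, for every type `t`, which vertex types are allowed at the end of an edge of
type `t`; nothing is allowed to grow on an edge of noise type. -/
structure Rule (LM LP : Type) (d : ℕ) where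
  allowed : LM ⊕ LP → Set (Multiset ((LM ⊕ LP) × MI d))
  nonempty : ∀ t, (allowed t).Nonempty
  noise : ∀ Ξ, allowed (Sum.inl Ξ) = {0}

/-- The vertex type of the root, and the statement that all other vertices obey the rule. -/
def Rule.conformAux (R : Rule LM LP d) :
    DTree LM LP d → Multiset ((LM ⊕ LP) × MI d) × Prop :=
  RTree.fold fun _ as bs =>
    (nodeType as bs, ∀ p ∈ bs, p.2.1 ∈ R.allowed (Sum.inr p.1.1) ∧ p.2.2)

/-- A tree strongly conforms to the rule if all vertices obey it, where the type of the root has to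
be allowed for at least one type. -/
def Rule.Conforms (R : Rule LM LP d) (τ : DTree LM LP d) : Prop :=
  (∃ t, (R.conformAux τ).1 ∈ R.allowed t) ∧ (R.conformAux τ).2

/-- The space `𝒯^ex`: the span of the decorated trees that strongly conform to the rule. -/
def TEx (R : Rule LM LP d) : Submodule ℝ (DTree LM LP d →₀ ℝ) :=
  Finsupp.supported ℝ ℝ {τ | R.Conforms τ}

/-- The generators of `𝒯₋^ex`: the conforming trees of negative degree. -/
abbrev NegTree (s : Setting LM LP d) (R : Rule LM LP d) : Type :=
  {τ : DTree LM LP d // R.Conforms τ ∧ s.degMinus τ < 0}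

/-- The algebra `𝒯₋^ex`: the free commutative algebra on the conforming trees of negative degree;
monomials are forests. Its characters `𝒢₋^ex` are the algebra morphisms
`TMinus s R →ₐ[ℝ] ℝ`. -/
abbrev TMinus (s : Setting LM LP d) (R : Rule LM LP d) : Type :=
  MvPolynomial (NegTree s R) ℝ

open Classical in
/-- The class in `𝒯₋^ex` of a tree: trees of non-negative degree are set to zero. -/
def projMinus (s : Setting LM LP d) (R : Rule LM LP d) (τ : DTree LM LP d) : TMinus s R :=
  if h : R.Conforms τ ∧ s.degMinus τ < 0 then MvPolynomial.X ⟨τ, h⟩ else 0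

/-! ### The coaction `Δ₋^ex`

The coaction is a sum over subforests `A` of `τ` (given by the set of edges of `A`), over vertex
decorations `𝔫_A ≤ 𝔫` supported on the vertices of `A`, and over edge decorations `ε` supported on
the edges that are not in `A` but start at a vertex of `A`. Such data is recorded in a *marked*
tree. The components of `A` that have no edge do not have to be considered: an uncoloured isolated
vertex has non-negative degree, as has a coloured isolated vertex with non-zero polynomial
decoration, and a coloured isolated vertex with vanishing polynomial decoration is identified with
the unit of `𝒯₋^ex` and is unchanged by the contraction. -/

/-- The marking of an edge: whether it belongs to `A`, and the value of `ε`. -/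
structure EdgeMark (d : ℕ) where
  inA : Bool
  eps : MI d

/-- Trees with a choice of `A`, `𝔫_A`, `ε`. -/
abbrev MTree (LM LP : Type) (d : ℕ) : Type :=
  RTree (NodeDec LM LP d × MI d) ((LM × MI d) × EdgeMark d) ((LP × MI d) × EdgeMark d)

/-- Some edge that starts at the vertex belongs to `A`. -/
def Touched {X : Type} (as : Multiset ((LM × MI d) × EdgeMark d))
    (bs : Multiset (((LP × MI d) × EdgeMark d) × X)) : Prop :=
  (∃ a ∈ as, a.2.inA = true) ∨ (∃ p ∈ bs, p.1.2.inA = true)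

/-- The support conditions on `𝔫_A` and `ε`: the vertex decoration `𝔫_A` vanishes outside the
vertices of `A`, and `ε` vanishes on the edges of `A` and on the edges that do not start at a vertex
of `A`. The boolean argument says whether the edge below the root belongs to `A`. -/
def Admissible : MTree LM LP d → Bool → Prop :=
  RTree.fold fun n as bs below =>
    ((below = true ∨ Touched as bs) ∨
      (n.2 = 0 ∧ (∀ a ∈ as, a.2.eps = 0) ∧ ∀ p ∈ bs, p.1.2.eps = 0)) ∧
    (∀ a ∈ as, a.2.inA = true → a.2.eps = 0) ∧
    ∀ p ∈ bs, (p.1.2.inA = true → p.1.2.eps = 0) ∧ p.2 p.1.2.inA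

/-- Factorial of a multi-index. -/
def mfact (k : MI d) : ℕ := ∏ i, (k i).factorial

/-- Binomial coefficient of multi-indices. -/
def mchoose (n k : MI d) : ℕ := ∏ i, (n i).choose (k i)

/-- The coefficient `(1/ε!) binom(𝔫, 𝔫_A)`. -/
def markCoeff : MTree LM LP d → ℝ :=
  RTree.fold fun n as bs => (mchoose n.1.1 n.2 : ℝ)
    * (as.map fun a => ((mfact a.2.eps : ℝ))⁻¹).prod
    * (bs.map fun p => ((mfact p.1.2.eps : ℝ))⁻¹ * p.2).prod

/-- A multi-index as an extended decoration. -/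
def MI.toO (k : MI d) : ODec LM LP d := (fun i => (k i : ℤ), 0)

/-- A type as an extended decoration. -/
def typeO (t : LM ⊕ LP) : ODec LM LP d := (0, Finsupp.single t 1)

/-- What has to be remembered of a marked tree in order to compute the extracted forest and the
contracted tree. The *root piece* is the connected component of the root in `A` (just the root if no
edge at the root belongs to `A`).
* `colour`: the colour and extended decoration of the root itself;
* `touched`: some edge of `A` starts at the root;
* `comp`: the root piece as a decorated tree, with vertex decoration `𝔫_A + πε`, where `(πε)(x)` is
  the sum of the values of `ε` on the edges starting at `x`;
* `label`: the sum over the vertices of the root piece of `𝔬 + 𝔫_A + πε`, plus the sum over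
  its edges of the types minus the derivative decorations;
* `poly`: the sum of `𝔫 - 𝔫_A` over the vertices of the root piece;
* `noises`, `kids`: the edges outside of `A` that start at the root piece, with derivative
  decoration `𝔢 + ε`, and with the contraction of the tree they lead to;
* `above`: the other components of `A`. -/
structure Piece (LM LP : Type) (d : ℕ) where
  colour : Option (ODec LM LP d)
  touched : Prop
  comp : DTree LM LP d
  label : ODec LM LP d
  poly : MI d
  noises : Multiset (LM × MI d)
  kids : Multiset ((LP × MI d) × DTree LM LP d)
  above : Multiset (DTree LM LP d)

open Classical in
/-- The contracted tree `τ / A`: every component of `A` is contracted to a coloured vertex. -/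
def Piece.contracted (p : Piece LM LP d) : DTree LM LP d :=
  RTree.node (p.poly, if p.touched then some p.label else p.colour) p.noises p.kids

open Classical in
/-- The extracted forest: all components of `A`. -/
def Piece.forest (p : Piece LM LP d) : Multiset (DTree LM LP d) :=
  if p.touched then p.comp ::ₘ p.above else p.above

/-- The piece of a marked tree. -/
def piece : MTree LM LP d → Piece LM LP d :=
  RTree.fold fun n as bs =>
    let asIn := as.filter fun a => a.2.inA = true
    let asOut := as.filter fun a => a.2.inA = false
    let bsIn := bs.filter fun p => p.1.2.inA = true
    let bsOut := bs.filter fun p => p.1.2.inA = false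
    let eps : MI d := (asOut.map fun a => a.2.eps).sum + (bsOut.map fun p => p.1.2.eps).sum
    { colour := n.1.2
      touched := Touched as bs
      comp := RTree.node (n.2 + eps, n.1.2) (asIn.map fun a => a.1)
        (bsIn.map fun p => (p.1.1, p.2.comp))
      label := n.1.2.getD 0 + n.2.toO + eps.toO
        + (asIn.map fun a => typeO (Sum.inl a.1.1) - a.1.2.toO).sum
        + (bsIn.map fun p => typeO (Sum.inr p.1.1.1) - p.1.1.2.toO + p.2.label).sum
      poly := (n.1.1 - n.2) + (bsIn.map fun p => p.2.poly).sum
      noises := (asOut.map fun a => (a.1.1, a.1.2 + a.2.eps))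
        + (bsIn.map fun p => p.2.noises).sum
      kids := (bsOut.map fun p => ((p.1.1.1, p.1.1.2 + p.1.2.eps), p.2.contracted))
        + (bsIn.map fun p => p.2.kids).sum
      above := (bsIn.map fun p => p.2.above).sum + (bsOut.map fun p => p.2.forest).sum }

/-- The multi-indices with entries at most `m`. -/
def boxMI (d m : ℕ) : Finset (MI d) := Fintype.piFinset fun _ => Finset.range (m + 1)

/-- The sum over all edges of the absolute values of homogeneity and derivative decoration. -/
def Setting.size (s : Setting LM LP d) : DTree LM LP d → ℝ :=
  RTree.fold fun _ as bs => (as.map fun a => |s.homNoise a.1| + s.mdeg a.2).sum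
    + (bs.map fun p => |s.homKer p.1.1| + s.mdeg p.1.2 + p.2).sum

/-- All ways to choose `A ⊆ τ`, `𝔫_A ≤ 𝔫` and `ε`, where all entries of `ε` are at most `m`. -/
def markings (m : ℕ) : DTree LM LP d → Multiset (MTree LM LP d) :=
  RTree.choices
    (fun n => (Finset.Iic n.1).val.map fun k => (n, k))
    (fun a => ((Finset.univ : Finset Bool) ×ˢ boxMI d m).val.map fun c => (a, ⟨c.1, c.2⟩))
    (fun b => ((Finset.univ : Finset Bool) ×ˢ boxMI d m).val.map fun c => (b, ⟨c.1, c.2⟩))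

open Classical in
/-- `Δ₋^ex τ`. If some entry of `ε` exceeds the size of `τ`, then one of the components of `A`,
decorated by `𝔫_A + πε`, has positive degree and the corresponding summand vanishes in `𝒯₋^ex`;
this is why only finitely many `ε` are considered. -/
def deltaTree (s : Setting LM LP d) (R : Rule LM LP d) (τ : DTree LM LP d) :
    TMinus s R ⊗[ℝ] (DTree LM LP d →₀ ℝ) :=
  (((markings ⌈s.size τ⌉₊ τ).filter fun M => Admissible M false).map fun M =>
    markCoeff M • (((piece M).forest.map (projMinus s R)).prod ⊗ₜ[ℝ]
      Finsupp.single (piece M).contracted (1 : ℝ))).sum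

/-- The coaction `Δ₋^ex`. -/
def deltaMinus (s : Setting LM LP d) (R : Rule LM LP d) :
    (DTree LM LP d →₀ ℝ) →ₗ[ℝ] TMinus s R ⊗[ℝ] (DTree LM LP d →₀ ℝ) :=
  Finsupp.linearCombination ℝ (deltaTree s R)

/-- The renormalisation operator `M^g = (g ⊗ Id) Δ₋^ex`. -/
def renorm (s : Setting LM LP d) (R : Rule LM LP d) (g : TMinus s R →ₐ[ℝ] ℝ) :
    (DTree LM LP d →₀ ℝ) →ₗ[ℝ] (DTree LM LP d →₀ ℝ) :=
  (TensorProduct.lid ℝ (DTree LM LP d →₀ ℝ)).toLinearMap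
    ∘ₗ TensorProduct.map g.toLinearMap LinearMap.id ∘ₗ deltaMinus s R

/-! ### The canonical lift -/

/-- The mixed partial derivative `D^k u`. -/
def mderiv (k : MI d) (u : Pt d → ℝ) : Pt d → ℝ :=
  (List.finRange (d + 1)).foldr
    (fun i v => (fun w x => fderiv ℝ w x (Pi.single i 1))^[k i] v) u

/-- The monomial `x^k`. -/
def mpow (x : Pt d) (k : MI d) : ℝ := ∏ i, x i ^ k i

/-- The (finitely many) multi-indices of scaled degree less than `γ`. -/
def Setting.below (s : Setting LM LP d) (γ : ℝ) : Finset (MI d) :=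
  {j ∈ boxMI d ⌈γ⌉₊ | s.mdeg j < γ}

/-- `D^k K_t * u` minus its Taylor polynomial at `z` up to (scaled) degree less than `γ`. -/
def Setting.integrate (s : Setting LM LP d) (t : LP) (k : MI d) (γ : ℝ) (z : Pt d)
    (u : Pt d → ℝ) (x : Pt d) : ℝ :=
  mderiv k (s.kernel t ⋆[ContinuousLinearMap.lsmul ℝ ℝ] u) x
    - ∑ j ∈ s.below γ, mpow (x - z) j / mfact j
      * mderiv (k + j) (s.kernel t ⋆[ContinuousLinearMap.lsmul ℝ ℝ] u) z

/-- Recursion for the canonical lift; the first component is the degree `|τ|₊`. -/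
def canonicalAux (s : Setting LM LP d) (f : LM → Pt d → ℝ) (z : Pt d) :
    DTree LM LP d → ℝ × (Pt d → ℝ) :=
  RTree.fold fun n as bs =>
    (s.mdeg n.1 + n.2.elim 0 s.odeg + (as.map fun a => s.homNoise a.1 - s.mdeg a.2).sum
      + (bs.map fun p => s.homKer p.1.1 - s.mdeg p.1.2 + p.2.1).sum,
     fun x => mpow (x - z) n.1 * (as.map fun a => mderiv a.2 (f a.1) x).prod
      * (bs.map fun p => s.integrate p.1.1 p.1.2 (s.homKer p.1.1 - s.mdeg p.1.2 + p.2.1) z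
          p.2.2 x).prod)

/-- `Π_z^f τ` for the canonical lift of the smooth functions `f`. -/
def canonicalTree (s : Setting LM LP d) (f : LM → Pt d → ℝ) (z : Pt d) (τ : DTree LM LP d) :
    Pt d → ℝ :=
  (canonicalAux s f z τ).2

theorem canonicalAux_fst (s : Setting LM LP d) (f : LM → Pt d → ℝ) (z : Pt d)
    (τ : DTree LM LP d) : (canonicalAux s f z τ).1 = s.degPlus τ := by
  induction τ using RTree.induction with
  | h n as bs ih =>
    unfold canonicalAux Setting.degPlus at *
    rw [RTree.fold_node, RTree.fold_node, Multiset.map_map, Multiset.map_map]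
    refine congrArg₂ _ rfl (congrArg _ (Multiset.map_congr rfl fun p hp => ?_))
    simp only [Function.comp]
    rw [ih p hp]

/-- The canonical lift is the admissible model that is multiplicative, maps polynomials to
polynomials centred at `z`, noise edges to (derivatives of) the noise, and inner edges to
convolution with the kernel minus a Taylor polynomial of degree less than `|I_k^t τ|₊`. -/
theorem canonicalTree_node (s : Setting LM LP d) (f : LM → Pt d → ℝ) (z : Pt d)
    (n : NodeDec LM LP d) (as : Multiset (LM × MI d))
    (bs : Multiset ((LP × MI d) × DTree LM LP d)) (x : Pt d) :
    canonicalTree s f z (RTree.node n as bs) x =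
      mpow (x - z) n.1 * (as.map fun a => mderiv a.2 (f a.1) x).prod
        * (bs.map fun p => s.integrate p.1.1 p.1.2
            (s.homKer p.1.1 - s.mdeg p.1.2 + s.degPlus p.2) z (canonicalTree s f z p.2) x).prod := by
  simp only [canonicalTree, ← canonicalAux_fst s f z]
  rw [canonicalAux, RTree.fold_node]
  simp only [Multiset.map_map, Function.comp_def]

/-- The linear map `Π_z^f`. -/
def canonicalPi (s : Setting LM LP d) (f : LM → Pt d → ℝ) (z : Pt d) :
    (DTree LM LP d →₀ ℝ) →ₗ[ℝ] (Pt d → ℝ) :=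
  Finsupp.linearCombination ℝ (canonicalTree s f z)

/-! ### The extended structure -/

/-- The extended set of noise types `𝔏₋ ⊔ (𝔏₋ × I)`. -/
abbrev ExtNoise (LM I : Type) : Type := LM ⊕ (LM × I)

/-- The projection `𝔮` on noise types. -/
def qNoise {I : Type} : ExtNoise LM I → LM := Sum.elim id Prod.fst

/-- The projection `𝔮` on all types. -/
def qType {I : Type} : ExtNoise LM I ⊕ LP → LM ⊕ LP := Sum.map qNoise id

/-- The homogeneities are extended by `|(Ξ, i)| = |Ξ|`. -/
def Setting.ext (s : Setting LM LP d) (I : Type) : Setting (ExtNoise LM I) LP d :=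
  { s with homNoise := fun Ξ => s.homNoise (qNoise Ξ) }

/-- The extended rule. -/
def Rule.ext (R : Rule LM LP d) (I : Type) : Rule (ExtNoise LM I) LP d where
  allowed := Sum.elim (fun _ => {0})
    (fun t => {N | N.map (fun x => (qType x.1, x.2)) ∈ R.allowed (Sum.inr t)})
  nonempty := by
    rintro (Ξ | t)
    · exact ⟨0, rfl⟩
    · obtain ⟨N, hN⟩ := R.nonempty (Sum.inr t)
      refine ⟨N.map (fun x => (Sum.map Sum.inl id x.1, x.2)), ?_⟩
      have h : ∀ x : (LM ⊕ LP) × MI d,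
          ((qType (I := I) (Sum.map Sum.inl id x.1), x.2) : (LM ⊕ LP) × MI d) = x := by
        rintro ⟨Ξ | t, k⟩ <;> rfl
      simpa [Multiset.map_map, Function.comp_def, h] using hN
  noise _ := rfl

/-- Vertex decorations as vertex decorations of the extended structure. -/
def NodeDec.embed (I : Type) (n : NodeDec LM LP d) : NodeDec (ExtNoise LM I) LP d :=
  (n.1, n.2.map fun o => (o.1, o.2.mapDomain (Sum.map Sum.inl id)))

/-- The embedding of the trees into the extended trees. -/
def embedTree (I : Type) : DTree LM LP d → DTree (ExtNoise LM I) LP d :=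
  RTree.map (NodeDec.embed I) (fun a => (Sum.inl a.1, a.2)) id

open Classical in
/-- The embedding of `𝒢₋^ex` into the characters of the extended structure: a character `g` is
extended in such a way that it vanishes on every tree outside of `𝒯₋^ex`. -/
def extChar (I : Type) {s : Setting LM LP d} {R : Rule LM LP d} (g : TMinus s R →ₐ[ℝ] ℝ) :
    TMinus (s.ext I) (R.ext I) →ₐ[ℝ] ℝ :=
  MvPolynomial.aeval fun σ =>
    if h : ∃ τ : NegTree s R, embedTree I τ.1 = σ.1 then g (MvPolynomial.X h.choose) else 0

/-- The tuple of functions `(h, k)`, indexed by the noise types of the onefold extension. -/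
def pairNoise (h k : LM → Pt d → ℝ) : ExtNoise LM Unit → Pt d → ℝ :=
  Sum.elim h fun p => k p.1

open Classical in
/-- All trees `(τ, 𝔱')`, where `𝔱'` runs over the maps on the edges of `τ` with `𝔮 ∘ 𝔱' = 𝔱`. -/
def shiftTrees [Fintype LM] : DTree LM LP d → Multiset (DTree (ExtNoise LM Unit) LP d) :=
  RTree.choices (fun n => {NodeDec.embed Unit n})
    (fun a => ({Ξ : ExtNoise LM Unit | qNoise Ξ = a.1} : Finset (ExtNoise LM Unit)).val.map
      fun Ξ => (Ξ, a.2))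
    (fun b => {b})

/-- The shift operator on the span of all trees. -/
def shiftAll [Fintype LM] :
    (DTree LM LP d →₀ ℝ) →ₗ[ℝ] (DTree (ExtNoise LM Unit) LP d →₀ ℝ) :=
  Finsupp.linearCombination ℝ fun τ =>
    ((shiftTrees τ).map fun σ => Finsupp.single σ (1 : ℝ)).sum

theorem map_eq_map_of_rel {X Y Z : Type} {u : X → Z} {v : Y → Z} {s : Multiset X}
    {t : Multiset Y} (h : Multiset.Rel (fun x y => u x = v y) s t) : s.map u = t.map v := by
  rw [← Multiset.rel_eq, Multiset.rel_map]
  exact h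

theorem shiftTrees_conformAux [Fintype LM] (R : Rule LM LP d) (τ : DTree LM LP d) :
    ∀ σ ∈ shiftTrees τ,
      ((R.ext Unit).conformAux σ).1.map (fun x => (qType x.1, x.2)) = (R.conformAux τ).1 ∧
      ((R.conformAux τ).2 → ((R.ext Unit).conformAux σ).2) := by
  induction τ using RTree.induction with
  | h n as bs ih =>
    intro σ hσ
    rw [shiftTrees, RTree.choices, RTree.fold_node] at hσ
    obtain ⟨⟨n', as', bs'⟩, hc, rfl⟩ := Multiset.mem_map.1 hσ
    simp only [Multiset.mem_product, Multiset.mem_sections, Multiset.map_map,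
      Multiset.rel_map_left] at hc
    obtain ⟨-, has, hbs⟩ := hc
    replace has : Multiset.Rel (fun (y : LM × MI d) (x : ExtNoise LM Unit × MI d) =>
        (qNoise x.1, x.2) = y) as as' := by
      refine has.mono fun y _ x _ hxy => ?_
      obtain ⟨Ξ, hΞ, rfl⟩ := Multiset.mem_map.1 hxy
      exact Prod.ext (by simpa using hΞ) rfl
    replace hbs : Multiset.Rel (fun (y : (LP × MI d) × DTree LM LP d)
        (x : (LP × MI d) × DTree (ExtNoise LM Unit) LP d) =>
          y ∈ bs ∧ x.1 = y.1 ∧ x.2 ∈ shiftTrees y.2) bs bs' := by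
      refine hbs.mono fun y hy x _ hxy => ⟨hy, ?_⟩
      obtain ⟨h1, h2⟩ := Multiset.mem_product.1 hxy
      exact ⟨Multiset.mem_singleton.1 h1, h2⟩
    simp only [Rule.conformAux, RTree.fold_node]
    refine ⟨?_, fun hp x hx => ?_⟩
    · simp only [nodeType, Multiset.map_add, Multiset.map_map]
      refine congrArg₂ _ ?_ ?_
      · refine (map_eq_map_of_rel (has.mono fun y _ x _ hxy => ?_)).symm
        rw [← hxy]
        rfl
      · refine (map_eq_map_of_rel (hbs.mono fun y _ x _ hxy => ?_)).symm
        simp only [Function.comp_apply, hxy.2.1]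
        rfl
    · obtain ⟨x, hx', rfl⟩ := Multiset.mem_map.1 hx
      obtain ⟨y, hy, hyx, hxs⟩ : ∃ y ∈ bs, x.1 = y.1 ∧ x.2 ∈ shiftTrees y.2 := by
        obtain ⟨y, hy, hxy⟩ := Multiset.exists_mem_of_rel_of_mem (Multiset.rel_flip.2 hbs) hx'
        exact ⟨y, hy, hxy.2⟩
      obtain ⟨h1, h2⟩ := ih y hy x.2 hxs
      obtain ⟨h3, h4⟩ := hp _ (Multiset.mem_map_of_mem _ hy)
      refine ⟨?_, h2 h4⟩
      change Multiset.map _ _ ∈ R.allowed (Sum.inr x.1.1)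
      rw [hyx]
      exact h1 ▸ h3

theorem shiftAll_mem [Fintype LM] (R : Rule LM LP d) (x : DTree LM LP d →₀ ℝ) (hx : x ∈ TEx R) :
    shiftAll x ∈ TEx (R.ext Unit) := by
  rw [shiftAll, Finsupp.linearCombination_apply]
  refine Submodule.sum_mem (TEx (R.ext Unit)) fun τ hτ => Submodule.smul_mem _ (x τ) ?_
  refine multiset_sum_mem _ fun y hy => ?_
  obtain ⟨σ, hσ, rfl⟩ := Multiset.mem_map.1 hy
  refine Finsupp.single_mem_supported ℝ 1 ?_
  obtain ⟨h1, h2⟩ := shiftTrees_conformAux R τ σ hσ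
  obtain ⟨⟨t, ht⟩, h⟩ : R.Conforms τ := hx hτ
  refine ⟨?_, h2 h⟩
  rcases t with Ξ | t
  · rw [R.noise, Set.mem_singleton_iff, ← h1, Multiset.map_eq_zero] at ht
    exact ⟨Sum.inl (Sum.inl Ξ), ht⟩
  · rw [← h1] at ht
    exact ⟨Sum.inr t, ht⟩

/-- The shift operator `𝒮 : 𝒯^ex → 𝒯̂^ex`. -/
def shift [Fintype LM] (R : Rule LM LP d) : TEx R →ₗ[ℝ] TEx (R.ext Unit) :=
  shiftAll.restrict (shiftAll_mem R)

end

end RegStruct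

open RegStruct

namespace RegStruct

/-! Both sides expand into sums over trees carrying two independent choices: a marking `(A, 𝔫_A,
ε)`, coming from `Δ₋^ex`, and a labelling of the noise edges as plain or hatted, coming from `𝒮`.
Marks and labels do not interact, so labelling and then marking gives the same multiset as marking
and then labelling (`shiftTrees_bind_markings`). It suffices to fix a marked tree `M` and sum over
its labellings (`sum_renormTerm`).

For fixed `M` three observations settle the matter. Admissibility, coefficient, polynomial
decoration and `|·|₊` of the contracted tree do not depend on the labelling; this follows from
naturality of all constructions under renaming of noise types (`piece_rename` and its companions).
The extended character vanishes as soon as an extracted edge carries a hatted noise, and otherwise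
equals the original character on the unlabelled forest (`extChar_forest`), so the extracted edges
have just one surviving labelling. Each noise edge outside of `A` may be plain or hatted, which
contributes `D^k h + D^k k = D^k (h + k)`.

The last point must be propagated through the tree (`sum_labelMarked`). The lift of a contracted
tree is a product over the edges at the root piece, and the sum over labellings of a product
factorises into sums over the separate branches (`RTree.sum_choices_node`). On a kernel edge outside
of `A`, the sum passes through convolution, differentiation and subtraction of the Taylor
polynomial, because all of these are linear on smooth functions (`Setting.integrate_sum`) and the
order of the Taylor polynomial is the same for all labellings. -/

/-! ### Sums and products over multisets and their sections. -/

theorem exists_of_rel {X Y : Type} {r : X → Y → Prop} {s : Multiset X} {t : Multiset Y}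
    (h : Multiset.Rel r s t) :
    ∃ u : Multiset (X × Y), (∀ p ∈ u, r p.1 p.2) ∧ u.map Prod.fst = s ∧ u.map Prod.snd = t := by
  induction h with
  | zero => exact ⟨0, by simp⟩
  | @cons a b s t hab _ ih =>
    obtain ⟨u, h1, h2, h3⟩ := ih
    refine ⟨(a, b) ::ₘ u, ?_, by simp [h2], by simp [h3]⟩
    intro p hp
    rcases Multiset.mem_cons.1 hp with rfl | hp
    exacts [hab, h1 p hp]

/-- The distributive law: expanding a product of sums produces one term for each section. -/
theorem sum_sections_map {X Y S : Type} [CommSemiring S] (f : X → Multiset Y) (ψ : Y → S)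
    (s : Multiset X) :
    ((s.map f).Sections.map fun c => (c.map ψ).prod).sum
      = (s.map fun a => ((f a).map ψ).sum).prod := by
  induction s using Multiset.induction with
  | empty => simp
  | cons a s ih =>
    simp only [Multiset.map_cons, Multiset.sections_cons, Multiset.map_bind, Multiset.map_map,
      Multiset.sum_bind, Multiset.prod_cons, Function.comp_def, Multiset.sum_map_mul_left,
      ih, Multiset.sum_map_mul_right]

theorem sections_bind {X Y Z : Type} (f : X → Multiset Y) (g : Y → Multiset Z)
    (s : Multiset X) :
    ((s.map f).Sections.bind fun c => (c.map g).Sections)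
      = (s.map fun a => (f a).bind g).Sections := by
  induction s using Multiset.induction with
  | empty => simp
  | cons a s ih =>
    simp only [Multiset.map_cons, Multiset.sections_cons, Multiset.bind_assoc,
      Multiset.bind_map, ← ih, Multiset.map_bind]
    refine Multiset.bind_congr fun b _ => ?_
    rw [Multiset.bind_bind]

theorem product_bind {X Y Z W : Type} (s : Multiset X) (t : Multiset Y) (f : X → Multiset Z)
    (g : Y → Multiset W) :
    ((s ×ˢ t).bind fun p => f p.1 ×ˢ g p.2) = s.bind f ×ˢ t.bind g := by
  simp only [SProd.sprod, Multiset.product, Multiset.bind_assoc, Multiset.bind_map,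
    Multiset.map_bind]
  refine Multiset.bind_congr fun a _ => ?_
  rw [Multiset.bind_bind]

theorem sum_product_mul {X Y S : Type} [CommSemiring S] (s : Multiset X) (t : Multiset Y)
    (f : X → S) (g : Y → S) :
    ((s ×ˢ t).map fun p => f p.1 * g p.2).sum = (s.map f).sum * (t.map g).sum := by
  simp only [SProd.sprod, Multiset.product, Multiset.map_bind, Multiset.map_map,
    Multiset.sum_bind, Function.comp_def, Multiset.sum_map_mul_left, Multiset.sum_map_mul_right]

theorem filter_true_add_filter_false {X : Type} (p : X → Bool) (s : Multiset X) :
    (s.filter fun x => p x = true) + (s.filter fun x => p x = false) = s := by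
  conv_rhs => rw [← Multiset.filter_add_not (fun x => p x = true) s]
  simp

/-- Serves to merge the separate products over the edges in `A` and the edges outside of `A` into
one product over all edges at a vertex. -/
theorem prod_filter_mul_prod_filter {X S : Type} [CommMonoid S] (p : X → Bool) (s : Multiset X)
    (f g : X → S) :
    ((s.filter fun x => p x = true).map f).prod * ((s.filter fun x => p x = false).map g).prod
      = (s.map fun x => if p x = true then f x else g x).prod := by
  conv_rhs => rw [← filter_true_add_filter_false p s]
  rw [Multiset.map_add, Multiset.prod_add]
  congr 2 <;> refine Multiset.map_congr rfl fun x hx => ?_ <;>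
    simp [(Multiset.mem_filter.1 hx).2]

theorem map_sum_map {X Y Z : Type} (s : Multiset X) (f : X → Multiset Y) (g : Y → Z) :
    (s.map f).sum.map g = (s.map fun x => (f x).map g).sum := by
  induction s using Multiset.induction with
  | empty => simp
  | cons a s ih => simp [ih]

theorem prod_map_bind_sum {X Y S : Type} [CommMonoid S] (s : Multiset X) (f : X → Multiset Y)
    (g : Y → S) : ((s.map f).sum.map g).prod = (s.map fun x => ((f x).map g).prod).prod := by
  induction s using Multiset.induction with
  | empty => simp
  | cons a s ih => simp [ih]

/-! ### Functoriality of trees and sums over choices of decorations. -/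

namespace RTree

variable {N A B N' A' B' N'' A'' B'' : Type}

theorem map_node (fN : N → N') (fA : A → A') (fB : B → B') (n : N) (as : Multiset A)
    (bs : Multiset (B × RTree N A B)) :
    map fN fA fB (node n as bs)
      = node (fN n) (as.map fA) (bs.map fun p => (fB p.1, map fN fA fB p.2)) := by
  unfold map
  rw [fold_node]
  simp [Multiset.map_map]

theorem map_map (fN : N → N') (fA : A → A') (fB : B → B') (gN : N' → N'') (gA : A' → A'')
    (gB : B' → B'') (τ : RTree N A B) :
    map gN gA gB (map fN fA fB τ)
      = map (fun n => gN (fN n)) (fun a => gA (fA a)) (fun b => gB (fB b)) τ := by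
  induction τ using RTree.induction with
  | h n as bs ih =>
    simp only [map_node, Multiset.map_map, Function.comp_def]
    congr 1
    exact Multiset.map_congr rfl fun p hp => by rw [ih p hp]

theorem map_id' (τ : RTree N A B) : map (fun n => n) (fun a => a) (fun b => b) τ = τ := by
  induction τ using RTree.induction with
  | h n as bs ih =>
    simp only [map_node, Multiset.map_id']
    congr 1
    conv_rhs => rw [← Multiset.map_id' bs]
    exact Multiset.map_congr rfl fun p hp => by rw [ih p hp]

theorem choices_node (fN : N → Multiset N') (fA : A → Multiset A') (fB : B → Multiset B')
    (n : N) (as : Multiset A) (bs : Multiset (B × RTree N A B)) :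
    choices fN fA fB (node n as bs)
      = (fN n ×ˢ ((as.map fA).Sections
          ×ˢ (bs.map fun p => fB p.1 ×ˢ choices fN fA fB p.2).Sections)).map
        fun c => node c.1 c.2.1 c.2.2 := by
  unfold choices
  rw [fold_node]
  simp [Multiset.map_map]

theorem exists_of_mem_choices {fN : N → Multiset N'} {fA : A → Multiset A'}
    {fB : B → Multiset B'} {n : N} {as : Multiset A} {bs : Multiset (B × RTree N A B)}
    {σ : RTree N' A' B'} (h : σ ∈ choices fN fA fB (node n as bs)) :
    ∃ n' ∈ fN n, ∃ (u : Multiset (A × A'))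
      (v : Multiset ((B × RTree N A B) × (B' × RTree N' A' B'))),
      (∀ p ∈ u, p.2 ∈ fA p.1) ∧ u.map Prod.fst = as ∧
      (∀ p ∈ v, p.1 ∈ bs ∧ p.2.1 ∈ fB p.1.1 ∧ p.2.2 ∈ choices fN fA fB p.1.2) ∧
      v.map Prod.fst = bs ∧
      σ = node n' (u.map Prod.snd) (v.map Prod.snd) := by
  rw [choices_node] at h
  obtain ⟨⟨n', as', bs'⟩, hc, rfl⟩ := Multiset.mem_map.1 h
  simp only [Multiset.mem_product, Multiset.mem_sections, Multiset.rel_map_left] at hc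
  obtain ⟨hn, has, hbs⟩ := hc
  obtain ⟨u, hu, rfl, rfl⟩ := exists_of_rel has
  obtain ⟨v, hv, rfl, rfl⟩ := exists_of_rel hbs
  exact ⟨n', hn, u, v, hu, rfl, fun p hp => ⟨Multiset.mem_map_of_mem _ hp, hv p hp⟩, rfl, rfl⟩

/-- The choices at the root, on each leaf edge and in each branch are independent, so the sum of a
function that is multiplicative at the root factorises. This drives the induction in
`sum_labelMarked`. -/
theorem sum_choices_node {S : Type} [CommSemiring S] (fN : N → Multiset N')
    (fA : A → Multiset A') (fB : B → Multiset B') (φ : N' → S) (ψ : A' → S)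
    (θ : B' × RTree N' A' B' → S) (F : RTree N' A' B' → S)
    (hF : ∀ n as bs, F (node n as bs) = φ n * ((as.map ψ).prod * (bs.map θ).prod))
    (n : N) (as : Multiset A) (bs : Multiset (B × RTree N A B)) :
    ((choices fN fA fB (node n as bs)).map F).sum
      = ((fN n).map φ).sum * ((as.map fun a => ((fA a).map ψ).sum).prod
        * (bs.map fun p => ((fB p.1 ×ˢ choices fN fA fB p.2).map θ).sum).prod) := by
  rw [choices_node, Multiset.map_map]
  simp only [Function.comp_def, hF]
  rw [sum_product_mul _ _ φ fun c : Multiset A' × Multiset (B' × RTree N' A' B') =>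
      (c.1.map ψ).prod * (c.2.map θ).prod,
    sum_product_mul _ _ (fun c : Multiset A' => (c.map ψ).prod)
      fun c : Multiset (B' × RTree N' A' B') => (c.map θ).prod,
    sum_sections_map, sum_sections_map]

/-- Two rounds of choices can be made edge by edge and vertex by vertex. Exchanging the rounds thus
reduces to exchanging them on a single decoration. -/
theorem choices_bind (fN : N → Multiset N') (fA : A → Multiset A') (fB : B → Multiset B')
    (gN : N' → Multiset N'') (gA : A' → Multiset A'') (gB : B' → Multiset B'')
    (τ : RTree N A B) :
    (choices fN fA fB τ).bind (choices gN gA gB)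
      = choices (fun n => (fN n).bind gN) (fun a => (fA a).bind gA) (fun b => (fB b).bind gB)
        τ := by
  induction τ using RTree.induction with
  | h n as bs ih =>
    rw [choices_node, choices_node, Multiset.bind_map]
    simp only [choices_node]
    rw [← Multiset.map_bind]
    congr 1
    rw [product_bind (fN n) _ gN fun c : Multiset A' × Multiset (B' × RTree N' A' B') =>
        (c.1.map gA).Sections ×ˢ
          (c.2.map fun p => gB p.1 ×ˢ choices gN gA gB p.2).Sections,
      product_bind _ _ (fun c : Multiset A' => (c.map gA).Sections)
        fun c : Multiset (B' × RTree N' A' B') =>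
          (c.map fun p => gB p.1 ×ˢ choices gN gA gB p.2).Sections,
      sections_bind, sections_bind]
    congr 3
    refine Multiset.map_congr rfl fun p hp => ?_
    rw [← ih p hp, product_bind]

end RTree

noncomputable section

variable {L L' L'' LM LP I : Type} {d : ℕ}

/-! ### Renaming of noise types -/

/-- Renaming of the noise types in an extended decoration. -/
def renameO (ρ : L → L') : ODec L LP d →+ ODec L' LP d :=
  (AddMonoidHom.id _).prodMap (Finsupp.mapDomain.addMonoidHom (Sum.map ρ id))

/-- Renaming of the noise types in a vertex decoration. -/
def renameNode (ρ : L → L') (n : NodeDec L LP d) : NodeDec L' LP d :=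
  (n.1, n.2.map (renameO ρ))

/-- Renaming of the noise types in a tree. -/
def renameTree (ρ : L → L') : DTree L LP d → DTree L' LP d :=
  RTree.map (renameNode ρ) (fun a => (ρ a.1, a.2)) fun b => b

/-- Renaming of the noise types in a marked tree. -/
def renameMarked (ρ : L → L') : MTree L LP d → MTree L' LP d :=
  RTree.map (fun n => (renameNode ρ n.1, n.2)) (fun a => ((ρ a.1.1, a.1.2), a.2)) fun b => b

/-- Renaming of the noise types in a piece. -/
def Piece.rename (ρ : L → L') (p : Piece L LP d) : Piece L' LP d where
  colour := p.colour.map (renameO ρ)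
  touched := p.touched
  comp := renameTree ρ p.comp
  label := renameO ρ p.label
  poly := p.poly
  noises := p.noises.map fun a => (ρ a.1, a.2)
  kids := p.kids.map fun b => (b.1, renameTree ρ b.2)
  above := p.above.map (renameTree ρ)

theorem renameTree_node (ρ : L → L') (n : NodeDec L LP d) (as : Multiset (L × MI d))
    (bs : Multiset ((LP × MI d) × DTree L LP d)) :
    renameTree ρ (RTree.node n as bs) = RTree.node (renameNode ρ n)
      (as.map fun a => (ρ a.1, a.2)) (bs.map fun b => (b.1, renameTree ρ b.2)) :=
  RTree.map_node _ _ _ _ _ _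

theorem renameMarked_node (ρ : L → L') (n : NodeDec L LP d × MI d)
    (as : Multiset ((L × MI d) × EdgeMark d))
    (bs : Multiset (((LP × MI d) × EdgeMark d) × MTree L LP d)) :
    renameMarked ρ (RTree.node n as bs) = RTree.node (renameNode ρ n.1, n.2)
      (as.map fun a => ((ρ a.1.1, a.1.2), a.2)) (bs.map fun b => (b.1, renameMarked ρ b.2)) :=
  RTree.map_node _ _ _ _ _ _

theorem renameO_toO (ρ : L → L') (k : MI d) :
    renameO ρ (MI.toO k : ODec L LP d) = MI.toO k := by
  simp [renameO, MI.toO]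

theorem renameO_typeO (ρ : L → L') (t : L ⊕ LP) :
    renameO ρ (typeO t : ODec L LP d) = typeO (Sum.map ρ id t) := by
  simp [renameO, typeO, Finsupp.mapDomain_single]

theorem renameO_of_leftInverse {ρ : L → L'} {ρ' : L' → L} (h : ∀ x, ρ' (ρ x) = x)
    (o : ODec L LP d) : renameO ρ' (renameO ρ o) = o := by
  have hs : (Sum.map ρ' id ∘ Sum.map ρ id : L ⊕ LP → L ⊕ LP) = id := by
    funext x
    rcases x with x | x <;> simp [h]
  refine Prod.ext rfl ?_
  change Finsupp.mapDomain _ (Finsupp.mapDomain _ o.2) = o.2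
  rw [← Finsupp.mapDomain_comp, hs, Finsupp.mapDomain_id]

theorem renameNode_of_leftInverse {ρ : L → L'} {ρ' : L' → L} (h : ∀ x, ρ' (ρ x) = x)
    (n : NodeDec L LP d) : renameNode ρ' (renameNode ρ n) = n := by
  refine Prod.ext rfl ?_
  simp [renameNode, Option.map_map, Function.comp_def, renameO_of_leftInverse h]

theorem renameTree_of_leftInverse {ρ : L → L'} {ρ' : L' → L} (h : ∀ x, ρ' (ρ x) = x)
    (τ : DTree L LP d) : renameTree ρ' (renameTree ρ τ) = τ := by
  rw [renameTree, renameTree, RTree.map_map]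
  simp only [renameNode_of_leftInverse h, h, Prod.mk.eta]
  exact RTree.map_id' τ

theorem touched_rename {X Y : Type} (ρ : L → L') (f : X → Y)
    (as : Multiset ((L × MI d) × EdgeMark d))
    (bs : Multiset (((LP × MI d) × EdgeMark d) × X)) :
    Touched (as.map fun a => ((ρ a.1.1, a.1.2), a.2)) (bs.map fun b => (b.1, f b.2))
      = Touched as bs := by
  simp only [Touched, Multiset.mem_map, exists_exists_and_eq_and]

theorem Piece.contracted_rename (ρ : L → L') (p : Piece L LP d) :
    (p.rename ρ).contracted = renameTree ρ p.contracted := by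
  classical
  rw [Piece.contracted, Piece.contracted, renameTree_node]
  congr 1
  refine Prod.ext rfl ?_
  by_cases h : p.touched <;> simp [Piece.rename, renameNode, h]

theorem Piece.forest_rename (ρ : L → L') (p : Piece L LP d) :
    (p.rename ρ).forest = p.forest.map (renameTree ρ) := by
  classical
  by_cases h : p.touched <;> simp [Piece.forest, Piece.rename, h]

/-- The recursion for `piece`, with the fold on each branch rewritten as the piece of that branch.
-/
theorem piece_node (n : NodeDec LM LP d × MI d) (as : Multiset ((LM × MI d) × EdgeMark d))
    (bs : Multiset (((LP × MI d) × EdgeMark d) × MTree LM LP d)) :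
    piece (RTree.node n as bs) =
      { colour := n.1.2
        touched := Touched as bs
        comp := RTree.node
          (n.2 + (((as.filter fun a => a.2.inA = false).map fun a => a.2.eps).sum
            + ((bs.filter fun p => p.1.2.inA = false).map fun p => p.1.2.eps).sum), n.1.2)
          ((as.filter fun a => a.2.inA = true).map fun a => a.1)
          ((bs.filter fun p => p.1.2.inA = true).map fun p => (p.1.1, (piece p.2).comp))
        label := n.1.2.getD 0 + n.2.toO
          + MI.toO (((as.filter fun a => a.2.inA = false).map fun a => a.2.eps).sum
            + ((bs.filter fun p => p.1.2.inA = false).map fun p => p.1.2.eps).sum)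
          + ((as.filter fun a => a.2.inA = true).map
              fun a => typeO (Sum.inl a.1.1) - a.1.2.toO).sum
          + ((bs.filter fun p => p.1.2.inA = true).map
              fun p => typeO (Sum.inr p.1.1.1) - p.1.1.2.toO + (piece p.2).label).sum
        poly := (n.1.1 - n.2)
          + ((bs.filter fun p => p.1.2.inA = true).map fun p => (piece p.2).poly).sum
        noises := ((as.filter fun a => a.2.inA = false).map fun a => (a.1.1, a.1.2 + a.2.eps))
          + ((bs.filter fun p => p.1.2.inA = true).map fun p => (piece p.2).noises).sum
        kids := ((bs.filter fun p => p.1.2.inA = false).map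
            fun p => ((p.1.1.1, p.1.1.2 + p.1.2.eps), (piece p.2).contracted))
          + ((bs.filter fun p => p.1.2.inA = true).map fun p => (piece p.2).kids).sum
        above := ((bs.filter fun p => p.1.2.inA = true).map fun p => (piece p.2).above).sum
          + ((bs.filter fun p => p.1.2.inA = false).map fun p => (piece p.2).forest).sum } := by
  conv_lhs => rw [piece, RTree.fold_node]
  -- `Touched` reads only the marks on the edges, so replacing the branches by their pieces does not
  -- affect it.
  have hT : Touched as (bs.map fun p => (p.1, piece p.2)) = Touched as bs := by simp [Touched]
  rw [← hT]
  simp only [Multiset.filter_map, Multiset.map_map, Function.comp_def]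
  rfl

/-- Extraction and contraction are steered by the marks alone: noise types are merely copied, or
added up in extended decorations, where renaming is additive. -/
theorem piece_rename (ρ : L → L') (M : MTree L LP d) :
    piece (renameMarked ρ M) = (piece M).rename ρ := by
  induction M using RTree.induction with
  | h n as bs ih =>
    rw [renameMarked_node, piece_node, piece_node, Piece.rename]
    congr 1
    · exact touched_rename ρ _ as bs
    · rw [renameTree_node]
      simp only [renameNode, Multiset.filter_map, Multiset.map_map, Function.comp_def]
      congr 1
      refine Multiset.map_congr rfl fun p hp => ?_
      rw [ih p (Multiset.mem_filter.1 hp).1]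
      rfl
    · simp only [renameNode, Multiset.filter_map, Multiset.map_map, Function.comp_def, map_add,
        renameO_toO, map_multiset_sum, map_sub, renameO_typeO, Sum.map_inl, Sum.map_inr, id]
      congr 2
      · congr 3
        rcases n.1.2 with _ | o <;> simp
      · refine Multiset.map_congr rfl fun p hp => ?_
        rw [ih p (Multiset.mem_filter.1 hp).1]
        rfl
    · simp only [renameNode, Multiset.filter_map, Multiset.map_map, Function.comp_def]
      congr 2
      refine Multiset.map_congr rfl fun p hp => ?_
      rw [ih p (Multiset.mem_filter.1 hp).1]
      rfl
    · simp only [Multiset.filter_map, Multiset.map_map, Function.comp_def, Multiset.map_add]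
      congr 1
      rw [map_sum_map]
      congr 1
      refine Multiset.map_congr rfl fun p hp => ?_
      rw [ih p (Multiset.mem_filter.1 hp).1]
      rfl
    · simp only [Multiset.filter_map, Multiset.map_map, Function.comp_def, Multiset.map_add]
      congr 1
      · refine Multiset.map_congr rfl fun p hp => ?_
        rw [ih p (Multiset.mem_filter.1 hp).1, Piece.contracted_rename]
      · rw [map_sum_map]
        congr 1
        refine Multiset.map_congr rfl fun p hp => ?_
        rw [ih p (Multiset.mem_filter.1 hp).1]
        rfl
    · simp only [Multiset.filter_map, Multiset.map_map, Function.comp_def, Multiset.map_add]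
      congr 1
      · rw [map_sum_map]
        congr 1
        refine Multiset.map_congr rfl fun p hp => ?_
        rw [ih p (Multiset.mem_filter.1 hp).1]
        rfl
      · rw [map_sum_map]
        congr 1
        refine Multiset.map_congr rfl fun p hp => ?_
        rw [ih p (Multiset.mem_filter.1 hp).1, Piece.forest_rename]

theorem markCoeff_rename (ρ : L → L') (M : MTree L LP d) :
    markCoeff (renameMarked ρ M) = markCoeff M := by
  induction M using RTree.induction with
  | h n as bs ih =>
    rw [renameMarked_node]
    unfold markCoeff at *
    simp only [RTree.fold_node, Multiset.map_map, Function.comp_def, renameNode]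
    congr 2
    refine Multiset.map_congr rfl fun p hp => ?_
    rw [ih p hp]

theorem admissible_rename (ρ : L → L') (M : MTree L LP d) (b : Bool) :
    Admissible (renameMarked ρ M) b ↔ Admissible M b := by
  induction M using RTree.induction generalizing b with
  | h n as bs ih =>
    rw [renameMarked_node]
    unfold Admissible at *
    simp only [RTree.fold_node, Multiset.map_map, Function.comp_def, Multiset.forall_mem_map_iff]
    refine and_congr (or_congr (or_congr Iff.rfl ?_) Iff.rfl) (and_congr Iff.rfl ?_)
    · simp only [Touched, Multiset.mem_map, exists_exists_and_eq_and]
    · exact forall₂_congr fun p hp => and_congr Iff.rfl (ih p hp _)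

/-! ### Degrees, size and conformity under the projection `𝔮`. -/

theorem odeg_rename (s : Setting LM LP d) (o : ODec (ExtNoise LM I) LP d) :
    s.odeg (renameO qNoise o) = (s.ext I).odeg o := by
  unfold Setting.odeg
  congr 1
  change (Finsupp.mapDomain _ o.2).sum _ = _
  rw [Finsupp.sum_mapDomain_index (by simp) (by intros; push_cast; ring)]
  refine Finsupp.sum_congr fun t _ => ?_
  rcases t with t | t <;> rfl

theorem degMinus_rename (s : Setting LM LP d) (τ : DTree (ExtNoise LM I) LP d) :
    s.degMinus (renameTree qNoise τ) = (s.ext I).degMinus τ := by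
  induction τ using RTree.induction with
  | h n as bs ih =>
    rw [renameTree_node]
    unfold Setting.degMinus at *
    simp only [RTree.fold_node, Multiset.map_map, Function.comp_def]
    refine congrArg₂ _ rfl (congrArg _ (Multiset.map_congr rfl fun p hp => ?_))
    rw [ih p hp]
    rfl

/-- Extended decorations remember the types of contracted edges, so a change of labels may change
colours; the degree is unaffected because `𝔮` preserves homogeneities. -/
theorem degPlus_rename (s : Setting LM LP d) (τ : DTree (ExtNoise LM I) LP d) :
    s.degPlus (renameTree qNoise τ) = (s.ext I).degPlus τ := by
  induction τ using RTree.induction with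
  | h n as bs ih =>
    rw [renameTree_node]
    unfold Setting.degPlus at *
    simp only [RTree.fold_node, Multiset.map_map, Function.comp_def]
    refine congrArg₂ _ (congrArg₂ _ (congrArg₂ _ rfl ?_) rfl)
      (congrArg _ (Multiset.map_congr rfl fun p hp => ?_))
    · rcases n with ⟨n, _ | o⟩
      · rfl
      · exact odeg_rename s o
    · rw [ih p hp]
      rfl

theorem size_rename (s : Setting LM LP d) (τ : DTree (ExtNoise LM I) LP d) :
    s.size (renameTree qNoise τ) = (s.ext I).size τ := by
  induction τ using RTree.induction with
  | h n as bs ih =>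
    rw [renameTree_node]
    unfold Setting.size at *
    simp only [RTree.fold_node, Multiset.map_map, Function.comp_def]
    refine congrArg₂ _ rfl (congrArg _ (Multiset.map_congr rfl fun p hp => ?_))
    rw [ih p hp]
    rfl

theorem conformAux_rename (R : Rule LM LP d) (τ : DTree (ExtNoise LM I) LP d) :
    (R.conformAux (renameTree qNoise τ)).1
        = ((R.ext I).conformAux τ).1.map (fun x => (qType x.1, x.2)) ∧
      ((R.conformAux (renameTree qNoise τ)).2 ↔ ((R.ext I).conformAux τ).2) := by
  induction τ using RTree.induction with
  | h n as bs ih =>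
    rw [renameTree_node]
    unfold Rule.conformAux at *
    simp only [RTree.fold_node, Multiset.map_map, Function.comp_def, Multiset.forall_mem_map_iff]
    refine ⟨?_, forall₂_congr fun p hp => ?_⟩
    · simp only [nodeType, Multiset.map_add, Multiset.map_map]
      rfl
    rw [(ih p hp).1, (ih p hp).2]
    rfl

/-- The extended rule is a preimage under `𝔮` on kernel types. On noise types only the empty
multiset is allowed, and its sole preimage under a map of multisets is empty. -/
theorem conforms_rename (R : Rule LM LP d) (τ : DTree (ExtNoise LM I) LP d) :
    R.Conforms (renameTree qNoise τ) ↔ (R.ext I).Conforms τ := by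
  obtain ⟨h1, h2⟩ := conformAux_rename R τ
  refine and_congr ⟨?_, ?_⟩ h2
  · rintro ⟨Ξ | t, ht⟩
    · rw [h1, R.noise, Set.mem_singleton_iff, Multiset.map_eq_zero] at ht
      exact ⟨Sum.inl (Sum.inl Ξ), ht⟩
    · rw [h1] at ht
      exact ⟨Sum.inr t, ht⟩
  · rintro ⟨Ξ | t, ht⟩
    · refine ⟨Sum.inl (qNoise Ξ), ?_⟩
      rw [h1, R.noise, Set.mem_singleton_iff, Multiset.map_eq_zero]
      exact ht
    · refine ⟨Sum.inr t, ?_⟩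
      rw [h1]
      exact ht

theorem embedTree_eq : embedTree (LM := LM) (LP := LP) (d := d) I = renameTree Sum.inl := rfl

theorem rename_embedTree (τ : DTree LM LP d) :
    renameTree (qNoise (I := I)) (embedTree I τ) = τ :=
  renameTree_of_leftInverse (fun _ => rfl) τ

end

noncomputable section

variable {LM LP : Type} {d : ℕ}

/-! ### Smoothness and linearity of the canonical lift -/

/-- Here the compact support belongs to the rough factor. Near a given point the convolution only
sees `g` on a bounded set, so `g` may be multiplied by a bump function, which reduces to the case of
a compactly supported smooth factor. -/
theorem contDiff_convolution_of_hasCompactSupport {E : Type} [NormedAddCommGroup E]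
    [NormedSpace ℝ E] [FiniteDimensional ℝ E] [MeasurableSpace E] [BorelSpace E]
    {μ : MeasureTheory.Measure E} {f g : E → ℝ} (hf : MeasureTheory.LocallyIntegrable f μ)
    (hcf : HasCompactSupport f) (hg : ContDiff ℝ ∞ g) :
    ContDiff ℝ ∞ (f ⋆[ContinuousLinearMap.lsmul ℝ ℝ, μ] g) := by
  rw [contDiff_iff_contDiffAt]
  intro x
  obtain ⟨r, hr⟩ := hcf.isCompact.isBounded.subset_closedBall (0 : E)
  let η : ContDiffBump (0 : E) :=
    -- For `y` within distance one of `x` and `t` in the support of `f`, the norm of `y - t` is at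
    -- most `‖x‖ + 1 + r`. The maximum with one keeps the radius positive, since `r` may be negative
    -- when the support is empty.
    ⟨max 1 (‖x‖ + 1 + r), max 1 (‖x‖ + 1 + r) + 1, by positivity, by linarith⟩
  have hη : ContDiff ℝ ∞ fun y => η y * g y := η.contDiff.mul hg
  have hc : HasCompactSupport fun y => η y * g y := η.hasCompactSupport.mul_right
  refine ((hc.contDiff_convolution_right (ContinuousLinearMap.lsmul ℝ ℝ) hf
    hη).contDiffAt (x := x)).congr_of_eventuallyEq ?_
  filter_upwards [Metric.ball_mem_nhds x one_pos] with y hy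
  rw [MeasureTheory.convolution, MeasureTheory.convolution]
  refine MeasureTheory.integral_congr_ae (Filter.Eventually.of_forall fun t => ?_)
  simp only
  by_cases ht : t ∈ tsupport f
  · have h1 : ‖t‖ ≤ r := by simpa using hr ht
    have h2 : ‖y‖ ≤ ‖x‖ + 1 := by
      have := norm_le_norm_add_norm_sub x y
      have h3 : ‖y - x‖ < 1 := by simpa [dist_eq_norm] using hy
      rw [norm_sub_rev] at h3
      linarith
    have h4 : η (y - t) = 1 := by
      refine η.one_of_mem_closedBall ?_
      have := norm_sub_le y t
      simp only [mem_closedBall_zero_iff]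
      exact le_trans (by linarith) (le_max_right _ _)
    rw [h4, one_mul]
  · rw [image_eq_zero_of_notMem_tsupport ht]
    simp

theorem contDiff_partial_iterate (v : Pt d) (m : ℕ) {u : Pt d → ℝ} (hu : ContDiff ℝ ∞ u) :
    ContDiff ℝ ∞ ((fun (w : Pt d → ℝ) x => fderiv ℝ w x v)^[m] u) := by
  induction m generalizing u with
  | zero => exact hu
  | succ m ih =>
    exact ih ((hu.fderiv_right (m := ∞) (by simp)).clm_apply contDiff_const)

theorem partial_iterate_linear (v : Pt d) (m : ℕ) {u w : Pt d → ℝ} (c : ℝ)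
    (hu : ContDiff ℝ ∞ u) (hw : ContDiff ℝ ∞ w) :
    (fun (w : Pt d → ℝ) x => fderiv ℝ w x v)^[m] (c • u + w)
      = c • (fun (w : Pt d → ℝ) x => fderiv ℝ w x v)^[m] u
        + (fun (w : Pt d → ℝ) x => fderiv ℝ w x v)^[m] w := by
  induction m generalizing u w with
  | zero => rfl
  | succ m ih =>
    simp only [Function.iterate_succ_apply]
    rw [← ih ((hu.fderiv_right (m := ∞) (by simp)).clm_apply contDiff_const)
      ((hw.fderiv_right (m := ∞) (by simp)).clm_apply contDiff_const)]
    congr 1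
    funext x
    have hu' := hu.differentiable (by simp) x
    have hw' := hw.differentiable (by simp) x
    rw [fderiv_add (hu'.const_smul c) hw', fderiv_const_smul hu']
    rfl

theorem contDiff_mderiv (k : MI d) {u : Pt d → ℝ} (hu : ContDiff ℝ ∞ u) :
    ContDiff ℝ ∞ (mderiv k u) := by
  unfold mderiv
  induction List.finRange (d + 1) with
  | nil => exact hu
  | cons i l ih => exact contDiff_partial_iterate _ _ ih

theorem mderiv_linear (k : MI d) {u w : Pt d → ℝ} (c : ℝ) (hu : ContDiff ℝ ∞ u)
    (hw : ContDiff ℝ ∞ w) : mderiv k (c • u + w) = c • mderiv k u + mderiv k w := by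
  -- Smoothness of the intermediate functions is carried through the induction, as each further
  -- derivative is additive only on differentiable functions.
  have key : ∀ l : List (Fin (d + 1)), ∀ f : Fin (d + 1) → (Pt d → ℝ) → Pt d → ℝ,
      (f = fun i v => (fun w x => fderiv ℝ w x (Pi.single i 1))^[k i] v) →
      ContDiff ℝ ∞ (l.foldr f u) ∧ ContDiff ℝ ∞ (l.foldr f w) ∧
        l.foldr f (c • u + w) = c • l.foldr f u + l.foldr f w := by
    rintro l f rfl
    induction l with
    | nil => exact ⟨hu, hw, rfl⟩
    | cons i l ih =>
      obtain ⟨h1, h2, h3⟩ := ih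
      refine ⟨contDiff_partial_iterate _ _ h1, contDiff_partial_iterate _ _ h2, ?_⟩
      simp only [List.foldr_cons]
      rw [h3, partial_iterate_linear _ _ c h1 h2]
  exact (key _ _ rfl).2.2

theorem mderiv_add (k : MI d) {u w : Pt d → ℝ} (hu : ContDiff ℝ ∞ u) (hw : ContDiff ℝ ∞ w) :
    mderiv k (u + w) = mderiv k u + mderiv k w := by
  simpa using mderiv_linear k 1 hu hw

theorem contDiff_mpow (z : Pt d) (k : MI d) : ContDiff ℝ ∞ fun x => mpow (x - z) k := by
  unfold mpow
  refine contDiff_prod fun i _ => ContDiff.pow ?_ _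
  simp only [Pi.sub_apply]
  exact (contDiff_apply ℝ ℝ i).sub contDiff_const

theorem Setting.contDiff_kernel_convolution (s : Setting LM LP d) (t : LP) {u : Pt d → ℝ}
    (hu : ContDiff ℝ ∞ u) :
    ContDiff ℝ ∞ (s.kernel t ⋆[ContinuousLinearMap.lsmul ℝ ℝ] u) :=
  contDiff_convolution_of_hasCompactSupport (s.kernel_integrable t).locallyIntegrable
    (s.kernel_compact t) hu

theorem Setting.kernel_convolution_linear (s : Setting LM LP d) (t : LP) {u w : Pt d → ℝ}
    (c : ℝ) (hu : ContDiff ℝ ∞ u) (hw : ContDiff ℝ ∞ w) :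
    (s.kernel t ⋆[ContinuousLinearMap.lsmul ℝ ℝ] (c • u + w))
      = c • (s.kernel t ⋆[ContinuousLinearMap.lsmul ℝ ℝ] u)
        + (s.kernel t ⋆[ContinuousLinearMap.lsmul ℝ ℝ] w) := by
  have hex : ∀ {v : Pt d → ℝ}, ContDiff ℝ ∞ v → MeasureTheory.ConvolutionExists (s.kernel t) v
      (ContinuousLinearMap.lsmul ℝ ℝ) MeasureTheory.volume := fun hv =>
    (s.kernel_compact t).convolutionExists_left_of_continuous_right _
      (s.kernel_integrable t).locallyIntegrable hv.continuous
  have hcu : ContDiff ℝ ∞ (c • u) := hu.const_smul c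
  rw [MeasureTheory.ConvolutionExists.distrib_add (hex hcu) (hex hw),
    MeasureTheory.convolution_smul]

theorem Setting.contDiff_integrate (s : Setting LM LP d) (t : LP) (k : MI d) (γ : ℝ) (z : Pt d)
    {u : Pt d → ℝ} (hu : ContDiff ℝ ∞ u) : ContDiff ℝ ∞ (s.integrate t k γ z u) := by
  unfold Setting.integrate
  refine (contDiff_mderiv k (s.contDiff_kernel_convolution t hu)).sub
    (ContDiff.sum fun j _ => ContDiff.mul ?_ contDiff_const)
  exact (contDiff_mpow z j).div_const _

theorem Setting.integrate_linear (s : Setting LM LP d) (t : LP) (k : MI d) (γ : ℝ) (z : Pt d)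
    {u w : Pt d → ℝ} (c : ℝ) (hu : ContDiff ℝ ∞ u) (hw : ContDiff ℝ ∞ w) (x : Pt d) :
    s.integrate t k γ z (c • u + w) x
      = c * s.integrate t k γ z u x + s.integrate t k γ z w x := by
  unfold Setting.integrate
  rw [s.kernel_convolution_linear t c hu hw]
  simp only [mderiv_linear _ c (s.contDiff_kernel_convolution t hu)
    (s.contDiff_kernel_convolution t hw), Pi.add_apply, Pi.smul_apply, smul_eq_mul, mul_sub,
    mul_add, Finset.sum_add_distrib, Finset.mul_sum]
  have : ∀ (j : MI d) (a : ℝ), mpow (x - z) j / (mfact j : ℝ) * (c * a)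
      = c * (mpow (x - z) j / (mfact j : ℝ) * a) := fun j a => by ring
  simp only [this]
  ring

theorem Setting.integrate_zero (s : Setting LM LP d) (t : LP) (k : MI d) (γ : ℝ) (z x : Pt d) :
    s.integrate t k γ z 0 x = 0 := by
  have h0 : ContDiff ℝ ∞ (0 : Pt d → ℝ) := contDiff_const
  -- With the scalar `-1` and both functions zero, linearity reads `I = -I + I`, hence `I = 0`.
  have := s.integrate_linear t k γ z (-1) h0 h0 x
  rw [show (-1 : ℝ) • (0 : Pt d → ℝ) + 0 = 0 by simp] at this
  linarith

theorem Setting.integrate_sum (s : Setting LM LP d) (t : LP) (k : MI d) (γ : ℝ) (z : Pt d)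
    {X : Type} (S : Multiset X) (c : X → ℝ) (u : X → Pt d → ℝ)
    (hu : ∀ i, ContDiff ℝ ∞ (u i)) (x : Pt d) :
    s.integrate t k γ z (fun y => (S.map fun i => c i * u i y).sum) x
      = (S.map fun i => c i * s.integrate t k γ z (u i) x).sum := by
  have hS : ∀ S : Multiset X, ContDiff ℝ ∞ fun y => (S.map fun i => c i * u i y).sum := by
    intro S
    induction S using Multiset.induction with
    | empty => simpa using contDiff_const
    | cons a S ih =>
      simp only [Multiset.map_cons, Multiset.sum_cons]
      exact (contDiff_const.mul (hu a)).add ih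
  induction S using Multiset.induction with
  | empty => exact s.integrate_zero t k γ z x
  | cons a S ih =>
    rw [Multiset.map_cons, Multiset.sum_cons, ← ih,
      ← s.integrate_linear t k γ z (c a) (hu a) (hS S)]
    congr 1
    funext y
    simp

theorem contDiff_multiset_prod {X : Type} (S : Multiset X) (u : X → Pt d → ℝ)
    (hu : ∀ i ∈ S, ContDiff ℝ ∞ (u i)) : ContDiff ℝ ∞ fun y => (S.map fun i => u i y).prod := by
  induction S using Multiset.induction with
  | empty => simpa using contDiff_const
  | cons a S ih =>
    simp only [Multiset.map_cons, Multiset.prod_cons]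
    exact (hu a (Multiset.mem_cons_self a S)).mul
      (ih fun i hi => hu i (Multiset.mem_cons_of_mem hi))

theorem contDiff_canonicalTree (s : Setting LM LP d) {f : LM → Pt d → ℝ}
    (hf : ∀ Ξ, ContDiff ℝ ∞ (f Ξ)) (z : Pt d) (τ : DTree LM LP d) :
    ContDiff ℝ ∞ (canonicalTree s f z τ) := by
  induction τ using RTree.induction with
  | h n as bs ih =>
    rw [funext (canonicalTree_node s f z n as bs)]
    refine ((contDiff_mpow z n.1).mul ?_).mul ?_
    · exact contDiff_multiset_prod as (fun a => mderiv a.2 (f a.1)) fun a _ =>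
        contDiff_mderiv _ (hf _)
    · exact contDiff_multiset_prod bs
        (fun p => s.integrate p.1.1 p.1.2 (s.homKer p.1.1 - s.mdeg p.1.2 + s.degPlus p.2) z
          (canonicalTree s f z p.2)) fun p hp => s.contDiff_integrate _ _ _ _ (ih p hp)

end

noncomputable section

variable {LM LP I : Type} {d : ℕ}

/-! ### Extended characters -/

/-- The indicator function of the original noise types. -/
def origNoise : ExtNoise LM I → ℝ := Sum.elim (fun _ => 1) fun _ => 0

open Classical in
/-- The indicator function of the trees without noises outside of `LM`. -/
def origTree : DTree (ExtNoise LM I) LP d → ℝ :=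
  RTree.fold fun n as bs =>
    (if renameNode Sum.inl (renameNode qNoise n) = n then 1 else 0)
      * ((as.map fun a => origNoise a.1).prod * (bs.map Prod.snd).prod)

theorem origTree_node (n : NodeDec (ExtNoise LM I) LP d) (as : Multiset (ExtNoise LM I × MI d))
    (bs : Multiset ((LP × MI d) × DTree (ExtNoise LM I) LP d))
    (hn : renameNode Sum.inl (renameNode qNoise n) = n) :
    origTree (RTree.node n as bs)
      = (as.map fun a => origNoise a.1).prod * (bs.map fun p => origTree p.2).prod := by
  unfold origTree
  rw [RTree.fold_node, if_pos hn, one_mul, Multiset.map_map]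
  rfl

theorem renameNode_qNoise_inl (n : NodeDec LM LP d) :
    renameNode (qNoise (I := I)) (renameNode Sum.inl n) = n :=
  renameNode_of_leftInverse (fun _ => rfl) n

theorem origTree_embedTree (τ : DTree LM LP d) : origTree (embedTree I τ) = 1 := by
  induction τ using RTree.induction with
  | h n as bs ih =>
    rw [embedTree_eq, renameTree_node, origTree_node _ _ _ (by rw [renameNode_qNoise_inl])]
    rw [Multiset.map_map, Multiset.map_map, Multiset.prod_eq_one, Multiset.prod_eq_one, one_mul]
    · intro y hy
      obtain ⟨p, hp, rfl⟩ := Multiset.mem_map.1 hy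
      exact ih p hp
    · intro y hy
      obtain ⟨p, hp, rfl⟩ := Multiset.mem_map.1 hy
      rfl

/-- A tree with non-zero indicator has only plain noises, on its edges and in its colours, and is
therefore recovered from its projection. -/
theorem origTree_eq (σ : DTree (ExtNoise LM I) LP d) :
    origTree σ = 0 ∨ embedTree I (renameTree qNoise σ) = σ := by
  induction σ using RTree.induction with
  | h n as bs ih =>
    refine or_iff_not_imp_left.2 fun h0 => ?_
    have hn : renameNode Sum.inl (renameNode qNoise n) = n := by
      by_contra hn
      exact h0 (by unfold origTree; rw [RTree.fold_node, if_neg hn, zero_mul])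
    rw [origTree_node _ _ _ hn] at h0
    have has : ∀ a ∈ as, (Sum.inl (qNoise a.1) : ExtNoise LM I) = a.1 := by
      rintro ⟨Ξ | Ξ, m⟩ ha
      · rfl
      · exact absurd (Multiset.prod_eq_zero (Multiset.mem_map.2 ⟨_, ha, rfl⟩))
          (left_ne_zero_of_mul h0)
    have hbs : ∀ p ∈ bs, embedTree I (renameTree qNoise p.2) = p.2 := fun p hp =>
      (ih p hp).resolve_left fun h =>
        right_ne_zero_of_mul h0 (Multiset.prod_eq_zero (Multiset.mem_map.2 ⟨p, hp, h⟩))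
    rw [embedTree_eq] at hbs ⊢
    rw [renameTree_node, renameTree_node, hn, Multiset.map_map, Multiset.map_map]
    congr 1
    · conv_rhs => rw [← Multiset.map_id' as]
      exact Multiset.map_congr rfl fun a ha => Prod.ext (has a ha) rfl
    · conv_rhs => rw [← Multiset.map_id' bs]
      exact Multiset.map_congr rfl fun p hp => Prod.ext rfl (hbs p hp)

/-- A formula for the extended character without a case distinction. Degree and conformity are
invariant under `𝔮`, so both sides see a generator at the same time. -/
theorem extChar_projMinus {s : Setting LM LP d} {R : Rule LM LP d} (g : TMinus s R →ₐ[ℝ] ℝ)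
    (σ : DTree (ExtNoise LM I) LP d) :
    extChar I g (projMinus (s.ext I) (R.ext I) σ)
      = origTree σ * g (projMinus s R (renameTree qNoise σ)) := by
  classical
  by_cases h : (R.ext I).Conforms σ ∧ (s.ext I).degMinus σ < 0
  · have h' : R.Conforms (renameTree qNoise σ) ∧ s.degMinus (renameTree qNoise σ) < 0 := by
      rwa [conforms_rename, degMinus_rename]
    rw [projMinus, projMinus, dif_pos h, dif_pos h', extChar, MvPolynomial.aeval_X]
    by_cases hσ : ∃ τ : NegTree s R, embedTree I τ.1 = σ
    · rw [dif_pos hσ]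
      -- The embedding has the left inverse `renameTree qNoise`, so the chosen preimage is the only
      -- one.
      have hτ : hσ.choose = ⟨renameTree qNoise σ, h'⟩ := by
        refine Subtype.ext ?_
        rw [← rename_embedTree (I := I) hσ.choose.1, hσ.choose_spec]
      rw [hτ]
      obtain ⟨τ, rfl⟩ := hσ
      rw [origTree_embedTree, one_mul]
    · rw [dif_neg hσ]
      rcases origTree_eq σ with h0 | h0
      · rw [h0, zero_mul]
      · exact absurd ⟨⟨_, h'⟩, h0⟩ hσ
  · have h' : ¬(R.Conforms (renameTree qNoise σ) ∧ s.degMinus (renameTree qNoise σ) < 0) := by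
      rwa [conforms_rename, degMinus_rename]
    rw [projMinus, projMinus, dif_neg h, dif_neg h', map_zero, map_zero, mul_zero]

/-- No colour contains a noise outside of `LM`. -/
def OrigColours : MTree (ExtNoise LM I) LP d → Prop :=
  RTree.fold fun n _ bs => renameNode Sum.inl (renameNode qNoise n.1) = n.1 ∧ ∀ p ∈ bs, p.2

theorem origColours_node (n : NodeDec (ExtNoise LM I) LP d × MI d)
    (as : Multiset ((ExtNoise LM I × MI d) × EdgeMark d))
    (bs : Multiset (((LP × MI d) × EdgeMark d) × MTree (ExtNoise LM I) LP d)) :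
    OrigColours (RTree.node n as bs)
      ↔ renameNode Sum.inl (renameNode qNoise n.1) = n.1 ∧ ∀ p ∈ bs, OrigColours p.2 := by
  unfold OrigColours
  rw [RTree.fold_node]
  simp only [Multiset.forall_mem_map_iff]

/-- The indicator function of the marked trees such that no extracted edge has a noise type
outside of `LM`. -/
def origMarked : MTree (ExtNoise LM I) LP d → ℝ :=
  RTree.fold fun _ as bs =>
    (as.map fun a => if a.2.inA = true then origNoise a.1.1 else 1).prod
      * (bs.map Prod.snd).prod

theorem origMarked_node (n : NodeDec (ExtNoise LM I) LP d × MI d)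
    (as : Multiset ((ExtNoise LM I × MI d) × EdgeMark d))
    (bs : Multiset (((LP × MI d) × EdgeMark d) × MTree (ExtNoise LM I) LP d)) :
    origMarked (RTree.node n as bs)
      = (as.map fun a => if a.2.inA = true then origNoise a.1.1 else 1).prod
        * (bs.map fun p => origMarked p.2).prod := by
  unfold origMarked
  rw [RTree.fold_node, Multiset.map_map]
  rfl

/-- The two factorisations are proved together: a branch on an edge of `A` contributes its root
component and the components above separately, since the former is glued to the component below,
whereas a branch on any other edge contributes its whole forest. -/
theorem origMarked_eq_prod (M : MTree (ExtNoise LM I) LP d) (hM : OrigColours M) :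
    origMarked M = origTree (piece M).comp * ((piece M).above.map origTree).prod ∧
      origMarked M = ((piece M).forest.map origTree).prod := by
  classical
  induction M using RTree.induction with
  | h n as bs ih =>
    rw [origColours_node] at hM
    have hn2 := congrArg Prod.snd hM.1
    have hn : ∀ k : MI d, renameNode Sum.inl (renameNode qNoise ((k, n.1.2) :
        NodeDec (ExtNoise LM I) LP d)) = (k, n.1.2) := fun k =>
      Prod.ext rfl hn2
    have key : origMarked (RTree.node n as bs)
        = origTree (piece (RTree.node n as bs)).comp
          * ((piece (RTree.node n as bs)).above.map origTree).prod := by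
      rw [origMarked_node, piece_node]
      simp only [origTree_node _ _ _ (hn _), Multiset.map_add, Multiset.prod_add,
        prod_map_bind_sum, Multiset.map_map, Function.comp_def]
      -- Regrouping pairs the root component of each branch in `A` with the components above it, so
      -- that the product becomes one over all kernel edges at the root.
      rw [mul_assoc, ← mul_assoc (Multiset.prod (Multiset.map (fun x => origTree _) _)),
        ← Multiset.prod_map_mul, prod_filter_mul_prod_filter
          fun p : ((LP × MI d) × EdgeMark d) × MTree (ExtNoise LM I) LP d => p.1.2.inA]
      congr 1
      · have := prod_filter_mul_prod_filter (fun a => a.2.inA) as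
          (fun a => origNoise a.1.1) fun _ => (1 : ℝ)
        rw [← this]
        simp
      · refine congrArg _ (Multiset.map_congr rfl fun p hp => ?_)
        obtain ⟨h1, h2⟩ := ih p hp (hM.2 p hp)
        split_ifs
        · exact h1
        · exact h2
    refine ⟨key, ?_⟩
    rw [key, Piece.forest]
    by_cases hT : (piece (RTree.node n as bs)).touched
    · rw [if_pos hT, Multiset.map_cons, Multiset.prod_cons]
    -- The root component is absent from the forest in this case. It is a single vertex without
    -- edges, so its indicator is one.
    · rw [if_neg hT]
      rw [piece_node] at hT ⊢
      simp only [Touched, not_or, not_exists, not_and] at hT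
      simp only [origTree_node _ _ _ (hn _)]
      rw [Multiset.filter_eq_nil.2 hT.1, Multiset.filter_eq_nil.2 hT.2]
      simp

/-- Multiplicativity of characters turns the tree-wise formula into one for forests; the indicators
multiply to the indicator of the marking. -/
theorem extChar_forest {s : Setting LM LP d} {R : Rule LM LP d} (g : TMinus s R →ₐ[ℝ] ℝ)
    (M : MTree (ExtNoise LM I) LP d) (hM : OrigColours M) :
    extChar I g (((piece M).forest.map (projMinus (s.ext I) (R.ext I))).prod)
      = origMarked M
        * g (((piece (renameMarked qNoise M)).forest.map (projMinus s R)).prod) := by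
  rw [(origMarked_eq_prod M hM).2, piece_rename, Piece.forest_rename, map_multiset_prod,
    map_multiset_prod, Multiset.map_map, Multiset.map_map, Multiset.map_map,
    ← Multiset.prod_map_mul]
  simp only [Function.comp_def, extChar_projMinus]

/-! ### The canonical lift of contracted trees -/

/-- The contribution to the canonical lift of the edges at the root piece. -/
def pieceLift (s : Setting LM LP d) (f : LM → Pt d → ℝ) (z x : Pt d) (p : Piece LM LP d) : ℝ :=
  (p.noises.map fun a => mderiv a.2 (f a.1) x).prod
    * (p.kids.map fun b => s.integrate b.1.1 b.1.2
        (s.homKer b.1.1 - s.mdeg b.1.2 + s.degPlus b.2) z (canonicalTree s f z b.2) x).prod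

/-- The colour of the root does not enter its own lift; colours matter only through `|·|₊` of the
branches further up. -/
theorem canonicalTree_contracted (s : Setting LM LP d) (f : LM → Pt d → ℝ) (z x : Pt d)
    (p : Piece LM LP d) :
    canonicalTree s f z p.contracted x = mpow (x - z) p.poly * pieceLift s f z x p := by
  rw [Piece.contracted, canonicalTree_node, pieceLift, mul_assoc]

/-- The contribution to the canonical lift of a kernel edge at the root piece. -/
def kidLift (s : Setting LM LP d) (f : LM → Pt d → ℝ) (z x : Pt d) (b : (LP × MI d) × EdgeMark d)
    (M : MTree LM LP d) : ℝ :=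
  if b.2.inA = true then pieceLift s f z x (piece M)
  else s.integrate b.1.1 (b.1.2 + b.2.eps)
    (s.homKer b.1.1 - s.mdeg (b.1.2 + b.2.eps) + s.degPlus (piece M).contracted) z
    (canonicalTree s f z (piece M).contracted) x

/-- The edges leaving the root piece are those outside of `A` at the root and those leaving the
pieces on top of edges of `A`. The lift is thus a product over the edges at the root, in which
extracted noise edges contribute one. -/
theorem pieceLift_node (s : Setting LM LP d) (f : LM → Pt d → ℝ) (z x : Pt d)
    (n : NodeDec LM LP d × MI d) (as : Multiset ((LM × MI d) × EdgeMark d))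
    (bs : Multiset (((LP × MI d) × EdgeMark d) × MTree LM LP d)) :
    pieceLift s f z x (piece (RTree.node n as bs))
      = (as.map fun a => if a.2.inA = true then 1
          else mderiv (a.1.2 + a.2.eps) (f a.1.1) x).prod
        * (bs.map fun p => kidLift s f z x p.1 p.2).prod := by
  rw [piece_node]
  unfold kidLift
  rw [← prod_filter_mul_prod_filter (fun a => a.2.inA) as,
    ← prod_filter_mul_prod_filter (fun p => p.1.2.inA) bs]
  simp only [pieceLift, Multiset.map_add, Multiset.prod_add, prod_map_bind_sum, Multiset.map_map,
    Function.comp_def, Multiset.map_const', Multiset.prod_replicate, one_pow,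
    Multiset.prod_map_mul]
  ring

/-! ### Labelled trees -/

open Classical in
/-- All maps of the noise types of the edges to the onefold extension over the identity. -/
def labelNoise [Fintype LM] (Ξ : LM) : Multiset (ExtNoise LM Unit) :=
  ({Ξ' : ExtNoise LM Unit | qNoise Ξ' = Ξ} : Finset (ExtNoise LM Unit)).val

theorem mem_labelNoise [Fintype LM] {Ξ : LM} {Ξ' : ExtNoise LM Unit} :
    Ξ' ∈ labelNoise Ξ ↔ qNoise Ξ' = Ξ := by
  simp [labelNoise]

theorem sum_labelNoise [Fintype LM] (Ξ : LM) (F : ExtNoise LM Unit → ℝ) :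
    ((labelNoise Ξ).map F).sum = F (Sum.inl Ξ) + F (Sum.inr (Ξ, ())) := by
  classical
  have : (Finset.univ.filter fun Ξ' : ExtNoise LM Unit => qNoise Ξ' = Ξ)
      = {Sum.inl Ξ, Sum.inr (Ξ, ())} := by
    ext (Ξ' | ⟨Ξ', u⟩) <;> simp only [Finset.mem_filter, Finset.mem_univ, true_and] <;>
      simp [qNoise]
  rw [← Finset.sum_pair (f := F) (by simp), ← this, labelNoise, Finset.sum]

/-- All lifts of a marked tree to the onefold extension. -/
def labelMarked [Fintype LM] : MTree LM LP d → Multiset (MTree (ExtNoise LM Unit) LP d) :=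
  RTree.choices (fun n => {(renameNode Sum.inl n.1, n.2)})
    (fun a => (labelNoise a.1.1).map fun Ξ => ((Ξ, a.1.2), a.2))
    (fun b => {b})

theorem of_mem_labelMarked [Fintype LM] (M : MTree LM LP d) :
    ∀ M' ∈ labelMarked M, renameMarked qNoise M' = M ∧ OrigColours M' := by
  induction M using RTree.induction with
  | h n as bs ih =>
    intro M' hM'
    obtain ⟨n', hn, u, v, hu, rfl, hv, rfl, rfl⟩ := RTree.exists_of_mem_choices hM'
    obtain rfl := Multiset.mem_singleton.1 hn
    rw [renameMarked_node, origColours_node]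
    refine ⟨?_, by rw [renameNode_qNoise_inl], ?_⟩
    · rw [renameNode_qNoise_inl, Multiset.map_map, Multiset.map_map]
      congr 1
      · refine Multiset.map_congr rfl fun p hp => ?_
        obtain ⟨Ξ, hΞ, h⟩ := Multiset.mem_map.1 (hu p hp)
        rw [mem_labelNoise] at hΞ
        rw [Function.comp_apply, ← h, hΞ]
      · refine Multiset.map_congr rfl fun p hp => ?_
        obtain ⟨h1, h2, h3⟩ := hv p hp
        exact Prod.ext (Multiset.mem_singleton.1 h2) (ih _ h1 _ h3).1
    · intro q hq
      obtain ⟨p, hp, rfl⟩ := Multiset.mem_map.1 hq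
      obtain ⟨h1, h2, h3⟩ := hv p hp
      exact (ih _ h1 _ h3).2

/-- The marks available at a vertex or an edge do not depend on noise types, and labels do not
depend on marks, so the two rounds of choices commute. -/
theorem shiftTrees_bind_markings [Fintype LM] (m : ℕ) (τ : DTree LM LP d) :
    (shiftTrees τ).bind (markings m) = (markings m τ).bind labelMarked := by
  unfold shiftTrees markings labelMarked
  rw [RTree.choices_bind, RTree.choices_bind]
  congr 1
  · funext n
    rw [Multiset.singleton_bind, Multiset.bind_map]
    exact (Multiset.bind_singleton _ _).symm
  · funext a
    rw [Multiset.bind_map, Multiset.bind_map]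
    change (labelNoise a.1).bind _ = _
    simp only [← Multiset.bind_singleton]
    rw [Multiset.bind_bind]
  · funext b
    rw [Multiset.singleton_bind, Multiset.bind_map]
    exact (Multiset.bind_singleton _ _).symm.trans rfl

theorem contDiff_pairNoise {h k : LM → Pt d → ℝ} (hh : ∀ Ξ, ContDiff ℝ ∞ (h Ξ))
    (hk : ∀ Ξ, ContDiff ℝ ∞ (k Ξ)) (Ξ : ExtNoise LM Unit) :
    ContDiff ℝ ∞ (pairNoise h k Ξ) := by
  rcases Ξ with Ξ | Ξ
  exacts [hh Ξ, hk Ξ.1]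

/-- The analytic core. It is stated for the root piece without its polynomial factor, because this
quantity is multiplicative also across edges of `A`. The induction is uniform in `x`, since
convolution needs the lift of a branch as a function. -/
theorem sum_labelMarked [Fintype LM] (s : Setting LM LP d) {h k : LM → Pt d → ℝ}
    (hh : ∀ Ξ, ContDiff ℝ ∞ (h Ξ)) (hk : ∀ Ξ, ContDiff ℝ ∞ (k Ξ)) (z : Pt d)
    (M : MTree LM LP d) (x : Pt d) :
    ((labelMarked M).map fun M' =>
        origMarked M' * pieceLift (s.ext Unit) (pairNoise h k) z x (piece M')).sum
      = pieceLift s (h + k) z x (piece M) := by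
  induction M using RTree.induction generalizing x with
  | h n as bs ih =>
    rw [pieceLift_node, labelMarked, RTree.sum_choices_node _ _ _ (fun _ => (1 : ℝ))
      (fun a => if a.2.inA = true then origNoise a.1.1
        else mderiv (a.1.2 + a.2.eps) (pairNoise h k a.1.1) x)
      (fun p => origMarked p.2 * kidLift (s.ext Unit) (pairNoise h k) z x p.1 p.2)]
    · simp only [Multiset.map_singleton, Multiset.sum_singleton, one_mul]
      congr 2
      · refine Multiset.map_congr rfl fun a _ => ?_
        rw [Multiset.map_map]
        simp only [Function.comp_def, sum_labelNoise]
        -- On an extracted edge the two labels contribute `1 + 0`; on any other edge they contribute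
        -- the derivatives of `h` and `k`, which add up.
        split_ifs
        · simp [origNoise]
        · exact (congrFun (mderiv_add _ (hh a.1.1) (hk a.1.1)) x).symm
      · refine Multiset.map_congr rfl fun p hp => ?_
        rw [show ({p.1} : Multiset ((LP × MI d) × EdgeMark d)) ×ˢ
            RTree.choices _ _ _ p.2 = (labelMarked p.2).map (Prod.mk p.1) from
          Multiset.singleton_bind _ _, Multiset.map_map]
        simp only [Function.comp_def, kidLift]
        split_ifs
        · exact ih p hp x
        -- The polynomial factor is common to all labellings, so the induction hypothesis for pieces
        -- yields the sum formula for the whole contracted branch.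
        · have hcon : canonicalTree s (h + k) z (piece p.2).contracted = fun y =>
              ((labelMarked p.2).map fun M' => origMarked M'
                * canonicalTree (s.ext Unit) (pairNoise h k) z (piece M').contracted y).sum := by
            funext y
            rw [canonicalTree_contracted, ← ih p hp y, ← Multiset.sum_map_mul_left]
            refine congrArg _ (Multiset.map_congr rfl fun M' hM' => ?_)
            rw [canonicalTree_contracted, ← (of_mem_labelMarked _ _ hM').1, piece_rename]
            exact mul_left_comm _ _ _
          rw [hcon, s.integrate_sum _ _ _ _ _ _ _ fun M' =>
            contDiff_canonicalTree _ (contDiff_pairNoise hh hk) z _]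
          refine congrArg _ (Multiset.map_congr rfl fun M' hM' => ?_)
          -- All labellings give the same degree, hence Taylor polynomials truncated at the same
          -- order.
          have hdeg : s.degPlus (piece p.2).contracted
              = (s.ext Unit).degPlus (piece M').contracted := by
            rw [← degPlus_rename, ← Piece.contracted_rename, ← piece_rename,
              (of_mem_labelMarked _ _ hM').1]
          rw [hdeg]
          rfl
    · intro n' as' bs'
      rw [origMarked_node, pieceLift_node, one_mul, mul_mul_mul_comm, ← Multiset.prod_map_mul,
        ← Multiset.prod_map_mul]
      congr 2
      refine Multiset.map_congr rfl fun a _ => ?_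
      split_ifs <;> simp

/-! ### Renormalisation and shift -/

theorem sum_map_filter {X S : Type} [AddCommMonoid S] (p : X → Prop) [DecidablePred p]
    (s : Multiset X) (f : X → S) :
    ((s.filter p).map f).sum = (s.map fun x => if p x then f x else 0).sum := by
  induction s using Multiset.induction with
  | empty => simp
  | cons a s ih => by_cases h : p a <;> simp [h, ih]

open Classical in
/-- The contribution of a marked tree to the canonical lift of a renormalised tree. -/
def renormTerm (s : Setting LM LP d) (R : Rule LM LP d) (g : TMinus s R →ₐ[ℝ] ℝ)
    (f : LM → Pt d → ℝ) (z x : Pt d) (M : MTree LM LP d) : ℝ :=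
  if Admissible M false then
    markCoeff M * (g (((piece M).forest.map (projMinus s R)).prod)
      * canonicalTree s f z (piece M).contracted x)
  else 0

/-- Inadmissible markings are kept with value zero, so that the sum runs over all of `markings`, a
multiset of free choices to which the exchange with labellings applies. -/
theorem canonicalPi_renorm_single (s : Setting LM LP d) (R : Rule LM LP d)
    (g : TMinus s R →ₐ[ℝ] ℝ) (f : LM → Pt d → ℝ) (z x : Pt d) (τ : DTree LM LP d) :
    canonicalPi s f z (renorm s R g (Finsupp.single τ 1)) x
      = ((markings ⌈s.size τ⌉₊ τ).map (renormTerm s R g f z x)).sum := by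
  classical
  have h1 : deltaMinus s R (Finsupp.single τ 1) = deltaTree s R τ := by simp [deltaMinus]
  rw [renorm, LinearMap.comp_apply, LinearMap.comp_apply, h1, deltaTree, map_multiset_sum,
    map_multiset_sum, map_multiset_sum, Multiset.map_map, Multiset.map_map, Multiset.map_map]
  have h2 := map_multiset_sum (Pi.evalAddMonoidHom (fun _ : Pt d => ℝ) x)
  simp only [Pi.evalAddMonoidHom_apply] at h2
  rw [h2, Multiset.map_map, sum_map_filter]
  refine congrArg _ (Multiset.map_congr rfl fun M _ => ?_)
  unfold renormTerm
  split_ifs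
  · simp only [Function.comp_apply, LinearEquiv.coe_coe, map_smul, TensorProduct.map_tmul,
      TensorProduct.lid_tmul, LinearMap.id_apply, canonicalPi, Finsupp.linearCombination_single,
      Pi.smul_apply, smul_eq_mul, one_smul, AlgHom.toLinearMap_apply]
  · rfl

theorem sum_renormTerm [Fintype LM] (s : Setting LM LP d) (R : Rule LM LP d)
    (g : TMinus s R →ₐ[ℝ] ℝ) {h k : LM → Pt d → ℝ}
    (hh : ∀ Ξ, ContDiff ℝ ∞ (h Ξ)) (hk : ∀ Ξ, ContDiff ℝ ∞ (k Ξ)) (z x : Pt d)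
    (M : MTree LM LP d) :
    ((labelMarked M).map (renormTerm (s.ext Unit) (R.ext Unit) (extChar Unit g)
        (pairNoise h k) z x)).sum
      = renormTerm s R g (h + k) z x M := by
  classical
  -- All factors that do not depend on the labelling are pulled out in front; what remains is the
  -- summand of `sum_labelMarked`.
  have hterm : ∀ M' ∈ labelMarked M,
      renormTerm (s.ext Unit) (R.ext Unit) (extChar Unit g) (pairNoise h k) z x M'
        = (if Admissible M false then markCoeff M
            * (g (((piece M).forest.map (projMinus s R)).prod) * mpow (x - z) (piece M).poly)
          else 0)
          * (origMarked M' * pieceLift (s.ext Unit) (pairNoise h k) z x (piece M')) := by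
    intro M' hM'
    obtain ⟨rfl, hc⟩ := of_mem_labelMarked M M' hM'
    rw [renormTerm, admissible_rename, markCoeff_rename, extChar_forest g M' hc,
      canonicalTree_contracted, show (piece (renameMarked qNoise M')).poly = (piece M').poly by
        rw [piece_rename]; rfl]
    split_ifs <;> ring
  rw [Multiset.map_congr rfl hterm, Multiset.sum_map_mul_left, sum_labelMarked s hh hk, renormTerm,
    canonicalTree_contracted]
  split_ifs <;> ring

/-- The size bounds the entries of `ε` in the definition of the coaction; equal sizes make the same
markings available before and after the shift. -/
theorem size_of_mem_shiftTrees [Fintype LM] (s : Setting LM LP d) (τ : DTree LM LP d) :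
    ∀ σ ∈ shiftTrees τ, (s.ext Unit).size σ = s.size τ := by
  suffices h : ∀ σ ∈ shiftTrees τ, renameTree qNoise σ = τ by
    intro σ hσ
    rw [← size_rename, h σ hσ]
  induction τ using RTree.induction with
  | h n as bs ih =>
    intro σ hσ
    obtain ⟨n', hn, u, v, hu, rfl, hv, rfl, rfl⟩ := RTree.exists_of_mem_choices hσ
    obtain rfl := Multiset.mem_singleton.1 hn
    rw [renameTree_node, Multiset.map_map, Multiset.map_map]
    congr 1
    · exact renameNode_qNoise_inl n
    · refine Multiset.map_congr rfl fun p hp => ?_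
      obtain ⟨Ξ, hΞ, h⟩ := Multiset.mem_map.1 (hu p hp)
      replace hΞ := mem_labelNoise.1 hΞ
      rw [Function.comp_apply, ← h, hΞ]
    · refine Multiset.map_congr rfl fun p hp => ?_
      obtain ⟨h1, h2, h3⟩ := hv p hp
      exact Prod.ext (Multiset.mem_singleton.1 h2) (ih _ h1 _ h3)

/-- By linearity it is enough to test on a single tree and at a single point, where both sides are
finite sums over marked trees. -/
theorem canonicalPi_renorm_shiftAll [Fintype LM] (s : Setting LM LP d) (R : Rule LM LP d)
    {h k : LM → Pt d → ℝ} (hh : ∀ Ξ, ContDiff ℝ ∞ (h Ξ)) (hk : ∀ Ξ, ContDiff ℝ ∞ (k Ξ))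
    (g : TMinus s R →ₐ[ℝ] ℝ) (z : Pt d) :
    canonicalPi s (h + k) z ∘ₗ renorm s R g =
      canonicalPi (s.ext Unit) (pairNoise h k) z
        ∘ₗ renorm (s.ext Unit) (R.ext Unit) (extChar Unit g) ∘ₗ shiftAll := by
  refine Finsupp.lhom_ext' fun τ => LinearMap.ext_ring ?_
  funext x
  have hshift : shiftAll (Finsupp.single τ (1 : ℝ))
      = ((shiftTrees τ).map fun σ => Finsupp.single σ (1 : ℝ)).sum := by simp [shiftAll]
  simp only [LinearMap.comp_apply, Finsupp.lsingle_apply]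
  rw [canonicalPi_renorm_single, hshift, map_multiset_sum, map_multiset_sum, Multiset.map_map,
    Multiset.map_map]
  have hx := map_multiset_sum (Pi.evalAddMonoidHom (fun _ : Pt d => ℝ) x)
  simp only [Pi.evalAddMonoidHom_apply] at hx
  rw [hx, Multiset.map_map]
  have hσ : ∀ σ ∈ shiftTrees τ, canonicalPi (s.ext Unit) (pairNoise h k) z
      (renorm (s.ext Unit) (R.ext Unit) (extChar Unit g) (Finsupp.single σ 1)) x
      = ((markings ⌈s.size τ⌉₊ σ).map (renormTerm (s.ext Unit) (R.ext Unit) (extChar Unit g)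
          (pairNoise h k) z x)).sum := fun σ hσ => by
    rw [canonicalPi_renorm_single, size_of_mem_shiftTrees s τ σ hσ]
  refine Eq.trans ?_ (congrArg _ (Multiset.map_congr rfl hσ)).symm
  -- The double sum over labellings and then markings is reordered, which leaves for each marked
  -- tree the sum over its labellings.
  rw [← Multiset.sum_bind, ← Multiset.map_bind, shiftTrees_bind_markings, Multiset.map_bind,
    Multiset.sum_bind]
  simp only [sum_renormTerm s R g hh hk]

end

end RegStruct

theorem mainTheorem10 {LM LP : Type} [Fintype LM] {d : ℕ} (s : Setting LM LP d)
    (R : Rule LM LP d) (h k : LM → Pt d → ℝ) (hh : ∀ Ξ, ContDiff ℝ ∞ (h Ξ))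
    (hk : ∀ Ξ, ContDiff ℝ ∞ (k Ξ)) (g : TMinus s R →ₐ[ℝ] ℝ) (z : Pt d) :
    canonicalPi s (h + k) z ∘ₗ renorm s R g ∘ₗ (TEx R).subtype =
      canonicalPi (s.ext Unit) (pairNoise h k) z
        ∘ₗ renorm (s.ext Unit) (R.ext Unit) (extChar Unit g)
        ∘ₗ (TEx (R.ext Unit)).subtype ∘ₗ shift R := by
  refine LinearMap.ext fun y => ?_
  -- The identity holds on the span of all decorated trees, and `shift R` is by definition a
  -- restriction of `shiftAll`.
  exact LinearMap.congr_fun (canonicalPi_renorm_shiftAll s R hh hk g z) y.1
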